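/- All graphs are finite and simple. A total coloring of a graph $G$ assigns colors to the vertices and edges of $G$ so that any two adjacent vertices, any two distinct edges with a common endpoint, and any vertex and edge incident with each other receive different colors. The total chromatic number $\chi''(G)$ is the least positive integer $k$ such that $G$ has a total coloring from a set of $k$ colors. A block of $G$ is a maximal connected subgraph without a cut vertex (of itself). $G$ is pseudo-outerplanar if each of its blocks can be drawn in the plane so that its vertices are distinct points of a circle, each of its edges is a simple arc that lies in the closed disk bounded by this circle, joins the two endpoints of the edge and passes through no other vertex, and each edge crosses at most one other edge (two different edges cross if their arcs have a common point that is not a vertex). Let $G$ be a graph with maximum degree $\Delta$. Then $\chi''(G)\ge \Delta+1$. If moreover $G$ is pseudo-outerplanar and $\Delta\ge 5$, then $G$ has a total coloring with $\Delta+1$ colors, and consequently $\chi''(G)=\Delta+1$. -/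

import Mathlib

namespace PseudoOuterplanar

variable {V : Type*}

/-- A total coloring of `G` with colors from `α`: vertices and edges are colored so that adjacent
vertices, distinct edges with a common endpoint, and a vertex and an edge incident with it
receive different colors. -/
structure TotalColoring (G : SimpleGraph V) (α : Type*) where
  vertexColor : V → α
  edgeColor : G.edgeSet → α
  vertex_ne : ∀ u v : V, G.Adj u v → vertexColor u ≠ vertexColor v
  edge_ne : ∀ e f : G.edgeSet, e ≠ f → (∃ v : V, v ∈ e.1 ∧ v ∈ f.1) → edgeColor e ≠ edgeColor f
  incident_ne : ∀ (v : V) (e : G.edgeSet), v ∈ e.1 → vertexColor v ≠ edgeColor e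

/-- `G` has a total coloring from a set of `k` colors. -/
def TotalColorable (G : SimpleGraph V) (k : ℕ) : Prop :=
  Nonempty (TotalColoring G (Fin k))

/-- The total chromatic number: the least positive integer `k` such that `G` has a `k`-total
coloring. -/
noncomputable def totalChromaticNumber (G : SimpleGraph V) : ℕ :=
  sInf {k : ℕ | 0 < k ∧ TotalColorable G k}

/-- A subgraph is nonseparable if it is connected (in particular it has a vertex) and has no cut
vertex. -/
def Nonseparable {G : SimpleGraph V} (H : G.Subgraph) : Prop :=
  H.Connected ∧ ∀ v ∈ H.verts, (H.deleteVerts {v}).Preconnected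

/-- A block of `G` is a maximal connected subgraph without a cut vertex. -/
def IsBlock {G : SimpleGraph V} (B : G.Subgraph) : Prop :=
  Maximal Nonseparable B

/-- A drawing of `G` in the closed unit disk of the plane: the vertices are distinct points of the
unit circle, and every edge is a simple arc in the disk that joins its two endpoints and passes
through no other vertex. -/
structure DiskDrawing (G : SimpleGraph V) where
  pos : V → ℂ
  pos_injective : Function.Injective pos
  pos_mem : ∀ v, pos v ∈ Metric.sphere (0 : ℂ) 1
  arc : G.edgeSet → unitInterval → ℂ
  arc_continuous : ∀ e, Continuous (arc e)
  arc_injective : ∀ e, Function.Injective (arc e)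
  arc_ends : ∀ e, s(arc e 0, arc e 1) = Sym2.map pos e.1
  arc_mem : ∀ e t, arc e t ∈ Metric.closedBall (0 : ℂ) 1
  arc_avoids : ∀ (e : G.edgeSet) (v : V), pos v ∈ Set.range (arc e) → v ∈ e.1

/-- Two different edges cross if their arcs have a common point that is not a vertex. -/
def DiskDrawing.Cross {G : SimpleGraph V} (D : DiskDrawing G) (e f : G.edgeSet) : Prop :=
  e ≠ f ∧ ∃ p : ℂ, p ∈ Set.range (D.arc e) ∧ p ∈ Set.range (D.arc f) ∧ p ∉ Set.range D.pos

/-- `G` is pseudo-outerplanar if each of its blocks has a drawing with the vertices on a circle and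
the edges inside the disk of this circle, in which every edge crosses at most one other edge. -/
def IsPseudoOuterplanar (G : SimpleGraph V) : Prop :=
  ∀ B : G.Subgraph, IsBlock B →
    ∃ D : DiskDrawing B.coe, ∀ e f f', D.Cross e f → D.Cross e f' → f = f'

end PseudoOuterplanar

/-! A vertex of maximum degree and its edges need pairwise different colors, which gives the lower
bound. For the upper bound, write `K` for the maximum degree and use `K + 1` colors.

Cut vertices are harmless (`ColorableOn.union`): the colors on one side can be permuted so that the
two colors of the cut vertex agree and its edges on the two sides are colored differently. A
nonseparable vertex set lies in a block, hence inherits its drawing. Arcs in the disk whose ends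
interleave on the circle must meet (`exists_eq_of_interleaving`, a winding number argument), so
ordering the vertices by argument yields a linear order in which each edge interleaves with at most
one other. Only this hereditary combinatorial property, `SingleCrossing`, is used from then on.

The rest is an induction on vertex sets by reducible configurations. By `exists_reducible`, every
nonempty set contains a vertex of low degree, a pair of twins, or, when `K = 5`, twins with three
ears. Each can be removed, the remainder colored, and the removed part colored from the free colors.
The configurations are found by cutting an interval that no edge leaves from its interior into two
or three shorter ones of the same kind (`Clean.dissect`): in an interval minimal with two interior
vertices, each piece has at most one, and counting neighbors of the cut points leaves only the
listed configurations (`Clean.card_inside_le_one`). -/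

namespace PseudoOuterplanar

open Complex

/-! ### Interleaving paths in the disk meet -/

/-- Two continuous logarithms of proportional functions have the same increment. -/
theorem sub_eq_sub_of_exp_eq_mul {φ ψ : unitInterval → ℂ} (hφ : Continuous φ) (hψ : Continuous ψ)
    (c : ℂ) (h : ∀ t, exp (φ t) = c * exp (ψ t)) : φ 1 - φ 0 = ψ 1 - ψ 0 := by
  have key := isCoveringMap_exp.const_of_comp (A := unitInterval) (g := fun t => φ t - ψ t)
    (hφ.sub hψ) (fun t t' => by
      ext
      simp [exp_sub, h, exp_ne_zero]) 1 0
  linear_combination key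

/-- As `z / a` lies in the closed unit disk, `1 - z / a` has positive real part unless `z / a = 1`.
Hence the principal logarithm is continuous along paths that avoid `a`. -/
theorem one_sub_div_mem_slitPlane {a z : ℂ} (ha : ‖a‖ = 1) (hz : ‖z‖ ≤ 1) (hne : z ≠ a) :
    1 - z / a ∈ slitPlane := by
  left
  have ha0 : a ≠ 0 := by
    rintro rfl
    simp at ha
  have hn : ‖z / a‖ ≤ 1 := by simpa [ha] using hz
  have hre : (z / a).re ≤ 1 := (re_le_norm _).trans hn
  rcases hre.lt_or_eq with hlt | heq
  · simpa using hlt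
  · exfalso
    have him : (z / a).im = 0 := by
      have h1 := Complex.sq_norm (z / a)
      rw [normSq_apply, heq] at h1
      have h2 : ‖z / a‖ ^ 2 ≤ 1 := by
        have := norm_nonneg (z / a)
        nlinarith
      nlinarith
    have h1 : z / a = 1 := Complex.ext (by simpa using heq) (by simpa using him)
    exact hne ((div_eq_one_iff_eq ha0).1 h1)

/-- The increment of a continuous logarithm of `a - γ t`, where `a` lies on the unit circle and
`γ` is a path in the closed unit disk that avoids `a`. -/
theorem log_increment {a c : ℂ} (ha : ‖a‖ = 1) {γ φ : unitInterval → ℂ} (hγ : Continuous γ)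
    (hφ : Continuous φ) (hball : ∀ t, ‖γ t‖ ≤ 1) (hne : ∀ t, γ t ≠ a)
    (h : ∀ t, exp (φ t) = c * (a - γ t)) :
    φ 1 - φ 0 = log (1 - γ 1 / a) - log (1 - γ 0 / a) := by
  have hs : ∀ t, 1 - γ t / a ∈ slitPlane := fun t => one_sub_div_mem_slitPlane ha (hball t) (hne t)
  have ha0 : a ≠ 0 := by
    rintro rfl
    simp at ha
  refine sub_eq_sub_of_exp_eq_mul (ψ := fun t => log (1 - γ t / a)) hφ
    (Continuous.clog (by fun_prop) hs) (c * a) fun t => ?_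
  rw [h, exp_log (slitPlane_ne_zero (hs t))]
  field_simp

/-- Half-angle formulas give the polar form `2 sin(θ/2) · exp(i(θ - π)/2)`, with a positive modulus
and an angle in the principal range. -/
theorem im_log_one_sub_exp {θ : ℝ} (h0 : 0 < θ) (h1 : θ < 2 * Real.pi) :
    (log (1 - exp (θ * I))).im = (θ - Real.pi) / 2 := by
  have hsin : 0 < 2 * Real.sin (θ / 2) := by
    have := Real.sin_pos_of_pos_of_lt_pi (x := θ / 2) (by linarith) (by linarith)
    linarith
  have key : 1 - exp (θ * I) = ((2 * Real.sin (θ / 2) : ℝ) : ℂ) *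
      (cos (((θ - Real.pi) / 2 : ℝ) : ℂ) + sin (((θ - Real.pi) / 2 : ℝ) : ℂ) * I) := by
    have e1 : Real.cos ((θ - Real.pi) / 2) = Real.sin (θ / 2) := by
      rw [show (θ - Real.pi) / 2 = θ / 2 - Real.pi / 2 by ring, Real.cos_sub_pi_div_two]
    have e2 : Real.sin ((θ - Real.pi) / 2) = -Real.cos (θ / 2) := by
      rw [show (θ - Real.pi) / 2 = θ / 2 - Real.pi / 2 by ring, Real.sin_sub_pi_div_two]
    have e3 : Real.cos θ = 1 - 2 * Real.sin (θ / 2) ^ 2 := by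
      rw [show θ = 2 * (θ / 2) by ring, Real.cos_two_mul, Real.cos_sq']
      ring_nf
    have e4 : Real.sin θ = 2 * Real.sin (θ / 2) * Real.cos (θ / 2) := by
      conv_lhs => rw [show θ = 2 * (θ / 2) by ring, Real.sin_two_mul]
    rw [exp_mul_I, ← ofReal_cos, ← ofReal_sin, ← ofReal_cos, ← ofReal_sin, e1, e2, e3, e4]
    push_cast
    ring
  rw [log_im, key, arg_mul_cos_add_sin_mul_I hsin ⟨by linarith, by linarith⟩]

theorem im_log_one_sub_exp_div {θ η : ℝ} (h0 : η < θ) (h1 : θ < η + 2 * Real.pi) :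
    (log (1 - exp (θ * I) / exp (η * I))).im = (θ - η - Real.pi) / 2 := by
  rw [← exp_sub, ← sub_mul, ← ofReal_sub, im_log_one_sub_exp (by linarith) (by linarith)]

theorem im_log_one_sub_exp_div' {θ η : ℝ} (h0 : θ < η) (h1 : η < θ + 2 * Real.pi) :
    (log (1 - exp (θ * I) / exp (η * I))).im = (θ - η + Real.pi) / 2 := by
  have e : exp (θ * I) = exp (((θ + 2 * Real.pi : ℝ) : ℂ) * I) := by
    push_cast
    rw [add_mul, exp_add, exp_two_pi_mul_I, mul_one]
  rw [e, im_log_one_sub_exp_div (by linarith) (by linarith)]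
  ring

/-- Two paths in the closed unit disk whose endpoints interleave on the unit circle meet. -/
theorem exists_eq_of_interleaving {γ₁ γ₂ : unitInterval → ℂ} (h₁ : Continuous γ₁)
    (h₂ : Continuous γ₂) (b₁ : ∀ t, ‖γ₁ t‖ ≤ 1) (b₂ : ∀ t, ‖γ₂ t‖ ≤ 1) {α β γ δ : ℝ}
    (hαγ : α < γ) (hγβ : γ < β) (hβδ : β < δ) (hδα : δ < α + 2 * Real.pi)
    (e₁₀ : γ₁ 0 = exp (α * I)) (e₁₁ : γ₁ 1 = exp (β * I))
    (e₂₀ : γ₂ 0 = exp (γ * I)) (e₂₁ : γ₂ 1 = exp (δ * I)) : ∃ s t, γ₁ s = γ₂ t := by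
  by_contra! hne
  -- Extending both paths to be constant outside the unit interval makes the difference a nowhere
  -- zero function on the plane, which has a continuous logarithm `L`.
  let p : ℝ → unitInterval := Set.projIcc 0 1 zero_le_one
  have hp : Continuous p := continuous_projIcc
  let F : ℝ × ℝ → ℂ := fun x => γ₁ (p x.1) - γ₂ (p x.2)
  have hF : Continuous F := by fun_prop
  have hF0 : ∀ x, F x ≠ 0 := fun x => sub_ne_zero.2 (hne _ _)
  obtain ⟨L, ⟨-, hexp⟩, -⟩ := isCoveringMapOn_exp.existsUnique_continuousMap_lifts
    ⟨F, hF⟩ (a₀ := 0) (exp_log (hF0 0)) hF0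
  have hexp' : ∀ s t : unitInterval, exp (L (s, t)) = γ₁ s - γ₂ t := by
    intro s t
    have := congrFun hexp ((s : ℝ), (t : ℝ))
    simpa [F, p, Set.projIcc_val] using this
  have hn : ∀ x : ℝ, ‖exp (x * I)‖ = 1 := norm_exp_ofReal_mul_I
  have s0 := log_increment (c := 1) (hn α) h₂ (φ := fun t => L ((0 : unitInterval), t))
    (by fun_prop) b₂ (fun t => by rw [← e₁₀]; exact (hne 0 t).symm)
    (fun t => by rw [hexp', e₁₀]; ring)
  have s1 := log_increment (c := 1) (hn β) h₂ (φ := fun t => L ((1 : unitInterval), t))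
    (by fun_prop) b₂ (fun t => by rw [← e₁₁]; exact (hne 1 t).symm)
    (fun t => by rw [hexp', e₁₁]; ring)
  have t0 := log_increment (c := -1) (hn γ) h₁ (φ := fun s => L (s, (0 : unitInterval)))
    (by fun_prop) b₁ (fun s => by rw [← e₂₀]; exact hne s 0)
    (fun s => by rw [hexp', e₂₀]; ring)
  have t1 := log_increment (c := -1) (hn δ) h₁ (φ := fun s => L (s, (1 : unitInterval)))
    (by fun_prop) b₁ (fun s => by rw [← e₂₁]; exact hne s 1)
    (fun s => by rw [hexp', e₂₁]; ring)
  rw [e₂₀, e₂₁] at s0 s1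
  rw [e₁₀, e₁₁] at t0 t1
  -- On each side of the parameter square one path rests at a point of the circle, so the increment
  -- of `Im L` is explicit. The two ways from corner `(0, 0)` to corner `(1, 1)` give values that
  -- differ by `2π`, a contradiction.
  have q0 := congrArg Complex.im s0
  have q1 := congrArg Complex.im s1
  have q2 := congrArg Complex.im t0
  have q3 := congrArg Complex.im t1
  simp only [sub_im] at q0 q1 q2 q3
  rw [im_log_one_sub_exp_div (by linarith) (by linarith),
    im_log_one_sub_exp_div (by linarith) (by linarith)] at q0
  rw [im_log_one_sub_exp_div (by linarith) (by linarith),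
    im_log_one_sub_exp_div' (by linarith) (by linarith)] at q1
  rw [im_log_one_sub_exp_div (by linarith) (by linarith),
    im_log_one_sub_exp_div' (by linarith) (by linarith)] at q2
  rw [im_log_one_sub_exp_div' (by linarith) (by linarith),
    im_log_one_sub_exp_div' (by linarith) (by linarith)] at q3
  linarith [Real.pi_pos]

/-! ### From drawings to linear orders -/

/-- The chords `ac` and `xy`, where `a < c` and `x < y`, interleave. -/
def Interleave {V : Type*} [LinearOrder V] (a c x y : V) : Prop :=
  (a < x ∧ x < c ∧ c < y) ∨ (x < a ∧ a < y ∧ y < c)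

/-- With the vertices on a line, every edge interleaves with at most one other edge. -/
def SingleCrossing {V : Type*} [LinearOrder V] (G : SimpleGraph V) : Prop :=
  ∀ a c x y x' y' : V, G.Adj a c → G.Adj x y → G.Adj x' y' →
    Interleave a c x y → Interleave a c x' y' → x = x' ∧ y = y'

/-- The arc of an edge can be run through in either direction. -/
theorem DiskDrawing.exists_path {V : Type*} {G : SimpleGraph V} (D : DiskDrawing G) {u v : V}
    (h : G.Adj u v) : ∃ γ : unitInterval → ℂ, Continuous γ ∧
      Set.range γ = Set.range (D.arc ⟨s(u, v), h⟩) ∧ γ 0 = D.pos u ∧ γ 1 = D.pos v := by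
  have he := D.arc_ends ⟨s(u, v), h⟩
  rw [Sym2.map_mk, Sym2.eq_iff] at he
  rcases he with ⟨h0, h1⟩ | ⟨h0, h1⟩
  · exact ⟨_, D.arc_continuous _, rfl, h0, h1⟩
  · refine ⟨fun t => D.arc ⟨s(u, v), h⟩ (unitInterval.symm t),
      (D.arc_continuous _).comp unitInterval.continuous_symm, ?_, by simpa using h1,
      by simpa using h0⟩
    exact unitInterval.symm_involutive.surjective.range_comp _

/-- The arcs meet by `exists_eq_of_interleaving`. The common point is no vertex: an arc contains
only the positions of its own ends, and the four ends are distinct. -/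
theorem DiskDrawing.cross_of_arg_lt {V : Type*} {G : SimpleGraph V} (D : DiskDrawing G)
    {a x c y : V} (hac : G.Adj a c) (hxy : G.Adj x y) (h1 : (D.pos a).arg < (D.pos x).arg)
    (h2 : (D.pos x).arg < (D.pos c).arg) (h3 : (D.pos c).arg < (D.pos y).arg) :
    D.Cross ⟨s(a, c), hac⟩ ⟨s(x, y), hxy⟩ := by
  obtain ⟨γ₁, hc1, hr1, s1, t1⟩ := D.exists_path hac
  obtain ⟨γ₂, hc2, hr2, s2, t2⟩ := D.exists_path hxy
  have hpos : ∀ v, D.pos v = Complex.exp ((D.pos v).arg * Complex.I) := by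
    intro v
    have hn : ‖D.pos v‖ = 1 := by simpa using D.pos_mem v
    conv_lhs => rw [← Complex.norm_mul_exp_arg_mul_I (D.pos v), hn]
    simp
  have hball : ∀ e t, ‖D.arc e t‖ ≤ 1 := fun e t => by simpa using D.arc_mem e t
  have hdisj : ∀ v : V, v ∈ s(a, c) → v ∈ s(x, y) → False := by
    intro v hv hv'
    rw [Sym2.mem_iff] at hv hv'
    rcases hv with rfl | rfl <;> rcases hv' with rfl | rfl <;> linarith
  obtain ⟨s, t, hst⟩ := exists_eq_of_interleaving hc1 hc2
    (fun t => by
      obtain ⟨t', ht'⟩ := hr1.subset (Set.mem_range_self t)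
      rw [← ht']
      exact hball _ _)
    (fun t => by
      obtain ⟨t', ht'⟩ := hr2.subset (Set.mem_range_self t)
      rw [← ht']
      exact hball _ _)
    h1 h2 h3
    (by linarith [Complex.arg_le_pi (D.pos y), Complex.neg_pi_lt_arg (D.pos a)])
    (s1.trans (hpos a)) (t1.trans (hpos c)) (s2.trans (hpos x)) (t2.trans (hpos y))
  have m1 : γ₁ s ∈ Set.range (D.arc ⟨s(a, c), hac⟩) := hr1 ▸ Set.mem_range_self s
  have m2 : γ₁ s ∈ Set.range (D.arc ⟨s(x, y), hxy⟩) := hr2 ▸ hst ▸ Set.mem_range_self t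
  refine ⟨fun he => ?_, γ₁ s, m1, m2, ?_⟩
  · have he' : s(a, c) = s(x, y) := congrArg Subtype.val he
    exact hdisj a (Sym2.mem_mk_left _ _) (he' ▸ Sym2.mem_mk_left _ _)
  · rintro ⟨v, hv⟩
    exact hdisj v (D.arc_avoids _ v (hv ▸ m1)) (D.arc_avoids _ v (hv ▸ m2))

/-- A drawing in which each edge crosses at most one other edge puts the vertices of any subgraph
on a line such that each edge interleaves with at most one other edge. -/
theorem DiskDrawing.exists_singleCrossing {V W : Type*} {G : SimpleGraph V} (D : DiskDrawing G)
    (hD : ∀ e f f', D.Cross e f → D.Cross e f' → f = f') (H : SimpleGraph W) (φ : W → V)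
    (hφ : Function.Injective φ) (hadj : ∀ u v, H.Adj u v → G.Adj (φ u) (φ v)) :
    ∃ _ : LinearOrder W, SingleCrossing H := by
  have hinj : Function.Injective fun w => (D.pos (φ w)).arg := by
    intro u v huv
    refine hφ (D.pos_injective (Complex.ext_norm_arg ?_ huv))
    have h1 := D.pos_mem (φ u)
    have h2 := D.pos_mem (φ v)
    simp only [mem_sphere_zero_iff_norm] at h1 h2
    rw [h1, h2]
  -- The circle is cut open at `-1`; whether two chords interleave does not depend on where it is
  -- cut.
  refine ⟨LinearOrder.lift' (fun w => (D.pos (φ w)).arg) hinj, ?_⟩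
  let _ : LinearOrder W := LinearOrder.lift' (fun w => (D.pos (φ w)).arg) hinj
  have hlt : ∀ u v : W, u < v ↔ (D.pos (φ u)).arg < (D.pos (φ v)).arg := fun u v => Iff.rfl
  have hcross : ∀ a c x y (hac : H.Adj a c) (hxy : H.Adj x y), Interleave a c x y →
      D.Cross ⟨s(φ a, φ c), hadj _ _ hac⟩ ⟨s(φ x, φ y), hadj _ _ hxy⟩ := by
    rintro a c x y hac hxy (⟨h1, h2, h3⟩ | ⟨h1, h2, h3⟩)
    · exact D.cross_of_arg_lt _ _ h1 h2 h3
    · obtain ⟨hne, p, hp1, hp2, hp⟩ := D.cross_of_arg_lt (hadj _ _ hxy) (hadj _ _ hac) h1 h2 h3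
      exact ⟨hne.symm, p, hp2, hp1, hp⟩
  have hord : ∀ a c x y : W, Interleave a c x y → x < y := by
    rintro a c x y (⟨h1, h2, h3⟩ | ⟨h1, h2, h3⟩)
    · exact h2.trans h3
    · exact h1.trans h2
  intro a c x y x' y' hac hxy hxy' h h'
  have heq := congrArg Subtype.val (hD _ _ _ (hcross _ _ _ _ hac hxy h)
    (hcross _ _ _ _ hac hxy' h'))
  rcases Sym2.eq_iff.1 heq with ⟨e1, e2⟩ | ⟨e1, e2⟩
  · exact ⟨hφ e1, hφ e2⟩
  · obtain rfl := hφ e1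
    obtain rfl := hφ e2
    exact absurd (hord _ _ _ _ h) (hord _ _ _ _ h').asymm

/-! ### Partial total colorings and one-vertex extensions -/

section Coloring

open scoped Classical

variable {V C : Type*} (G : SimpleGraph V)

/-- The neighbors of `v` in `S`. -/
noncomputable def nbr (S : Finset V) (v : V) : Finset V := S.filter (G.Adj v)

/-- `f` and `g` restrict to a total coloring of the subgraph induced on `S`. -/
structure ColoringOn (S : Finset V) (f : V → C) (g : V → V → C) : Prop where
  symm : ∀ u v, g u v = g v u
  vertex : ∀ u ∈ S, ∀ v ∈ S, G.Adj u v → f u ≠ f v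
  edge : ∀ u ∈ S, ∀ v ∈ S, ∀ w ∈ S, G.Adj u v → G.Adj u w → v ≠ w → g u v ≠ g u w
  incident : ∀ u ∈ S, ∀ v ∈ S, G.Adj u v → f u ≠ g u v

/-- The subgraph induced on `S` has a total coloring with colors in `C`. -/
def ColorableOn (C : Type*) (S : Finset V) : Prop :=
  ∃ (f : V → C) (g : V → V → C), ColoringOn G S f g

/-- The colors at `v` in a total coloring of the subgraph induced on `S`. -/
noncomputable def used (S : Finset V) (f : V → C) (g : V → V → C) (v : V) : Finset C :=
  insert (f v) ((nbr G S v).image (g v))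

variable {G} {S : Finset V} {f : V → C} {g : V → V → C}

@[simp] theorem mem_nbr {u v : V} : u ∈ nbr G S v ↔ u ∈ S ∧ G.Adj v u := by simp [nbr]

theorem nbr_insert_of_adj {u v : V} (h : G.Adj v u) :
    nbr G (insert u S) v = insert u (nbr G S v) := by
  ext w
  simp only [mem_nbr, Finset.mem_insert]
  grind

theorem nbr_insert_of_not_adj {u v : V} (h : ¬ G.Adj v u) :
    nbr G (insert u S) v = nbr G S v := by
  ext w
  simp only [mem_nbr, Finset.mem_insert]
  grind

theorem card_used_le (v : V) : (used G S f g v).card ≤ (nbr G S v).card + 1 :=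
  (Finset.card_insert_le _ _).trans (Nat.succ_le_succ Finset.card_image_le)

/-- A new vertex `u` gets the color `c₀` and its edges get the colors `k`. -/
theorem ColoringOn.extend (h : ColoringOn G S f g) {u : V} (hu : u ∉ S) (c₀ : C) (k : V → C)
    (hk : ∀ v ∈ nbr G S u, ∀ w ∈ nbr G S u, v ≠ w → k v ≠ k w)
    (hused : ∀ v ∈ nbr G S u, k v ∉ used G S f g v)
    (hf : ∀ v ∈ nbr G S u, c₀ ≠ f v) (hc : ∀ v ∈ nbr G S u, c₀ ≠ k v) :
    ∃ (f' : V → C) (g' : V → V → C), ColoringOn G (insert u S) f' g' ∧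
      (∀ v ∈ S, f' v = f v) ∧ f' u = c₀ ∧
      (∀ v ∈ nbr G S u, used G (insert u S) f' g' v = insert (k v) (used G S f g v)) ∧
      (∀ v ∈ S, v ∉ nbr G S u → used G (insert u S) f' g' v = used G S f g v) ∧
      used G (insert u S) f' g' u = insert c₀ ((nbr G S u).image k) := by
  have hne : ∀ v ∈ S, v ≠ u := fun v hv e => hu (e ▸ hv)
  have huu : ¬ G.Adj u u := G.loopless.irrefl u
  simp only [used, mem_nbr, Finset.mem_insert, Finset.mem_image, not_or, not_exists, not_and]
    at hk hused hf hc
  have himg : ∀ v ∈ S, (nbr G S v).image (fun y => if v = u then k y else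
      if y = u then k v else g v y) = (nbr G S v).image (g v) := by
    intro v hv
    refine Finset.image_congr fun y hy => ?_
    have hy' : y ∈ nbr G S v := hy
    rw [mem_nbr] at hy'
    simp [hne v hv, hne y hy'.1]
  refine ⟨Function.update f u c₀, fun x y => if x = u then k y else if y = u then k x else g x y,
    ⟨?_, ?_, ?_, ?_⟩, ?_, by simp, ?_, ?_, ?_⟩
  · intro x y
    have := h.symm x y
    grind
  · intro x hx y hy hxy
    have := h.vertex x
    have := hxy.symm
    simp only [Function.update_apply]
    grind
  · intro x hx y hy z hz hxy hxz hyz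
    have := h.edge x
    have := h.symm
    have := hxy.symm
    have := hxz.symm
    grind
  · intro x hx y hy hxy
    have := h.incident x
    have := hxy.symm
    simp only [Function.update_apply]
    grind
  · intro v hv
    simp [hne v hv]
  · intro v hv
    rw [mem_nbr] at hv
    simp only [used]
    rw [nbr_insert_of_adj hv.2.symm, Finset.image_insert, himg v hv.1, Finset.insert_comm]
    simp [hne v hv.1]
  · intro v hv hv'
    have hadj : ¬ G.Adj v u := fun e => hv' (mem_nbr.2 ⟨hv, e.symm⟩)
    simp only [used]
    rw [nbr_insert_of_not_adj hadj, himg v hv]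
    simp [hne v hv]
  · simp only [used]
    rw [nbr_insert_of_not_adj huu]
    simp

variable [Fintype C]

/-- A new vertex of degree at most two whose edges have been given suitable colors. -/
theorem ColoringOn.extend_of_card_le_two (h : ColoringOn G S f g) {u : V} (hu : u ∉ S)
    (hC : 5 ≤ Fintype.card C) (hdeg : (nbr G S u).card ≤ 2) (k : V → C)
    (hk : ∀ v ∈ nbr G S u, ∀ w ∈ nbr G S u, v ≠ w → k v ≠ k w)
    (hused : ∀ v ∈ nbr G S u, k v ∉ used G S f g v) :
    ∃ (f' : V → C) (g' : V → V → C), ColoringOn G (insert u S) f' g' ∧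
      (∀ v ∈ nbr G S u, used G (insert u S) f' g' v = insert (k v) (used G S f g v)) ∧
      (∀ v ∈ S, v ∉ nbr G S u → used G (insert u S) f' g' v = used G S f g v) := by
  -- The new vertex has to avoid at most two vertex colors and two edge colors, so five colors
  -- suffice.
  have hcard : ((nbr G S u).image f ∪ (nbr G S u).image k).card < Fintype.card C := by
    have h1 := Finset.card_union_le ((nbr G S u).image f) ((nbr G S u).image k)
    have h2 := Finset.card_image_le (s := nbr G S u) (f := f)
    have h3 := Finset.card_image_le (s := nbr G S u) (f := k)
    omega
  obtain ⟨c₀, hc₀⟩ : ∃ c₀, c₀ ∉ (nbr G S u).image f ∪ (nbr G S u).image k := by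
    by_contra! hall
    rw [Finset.eq_univ_iff_forall.2 hall, Finset.card_univ] at hcard
    exact hcard.false
  simp only [Finset.mem_union, Finset.mem_image, not_or, not_exists, not_and] at hc₀
  obtain ⟨f', g', h1, -, -, h2, h3, -⟩ := h.extend hu c₀ k hk hused
    (fun v hv e => hc₀.1 v hv e.symm) (fun v hv e => hc₀.2 v hv e.symm)
  exact ⟨f', g', h1, h2, h3⟩

/-- The colors free at a vertex. -/
theorem card_compl_used (v : V) :
    Fintype.card C ≤ (used G S f g v)ᶜ.card + (nbr G S v).card + 1 := by
  have h1 := card_used_le (G := G) (S := S) (f := f) (g := g) v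
  have h2 := Finset.card_add_card_compl (used G S f g v)
  omega

theorem card_nbr_insert {u v : V} (hu : u ∉ S) (h : G.Adj v u) :
    (nbr G (insert u S) v).card = (nbr G S v).card + 1 := by
  rw [nbr_insert_of_adj h, Finset.card_insert_of_notMem (by simp [hu])]

/-- A vertex of degree at most two, one of whose neighbors has degree less than `K`, is
reducible. -/
theorem ColorableOn.insert_of_card_le_two {K : ℕ} (h : ColorableOn G C S) {u : V} (hu : u ∉ S)
    (hK : 4 ≤ K) (hC : Fintype.card C = K + 1) (hmax : ∀ v, (nbr G (insert u S) v).card ≤ K)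
    (hdeg : (nbr G S u).card ≤ 2)
    (hred : (nbr G S u).card = 2 → ∃ v ∈ nbr G S u, (nbr G (insert u S) v).card < K) :
    ColorableOn G C (insert u S) := by
  obtain ⟨f, g, h⟩ := h
  have hcard : ∀ v ∈ nbr G S u, (nbr G (insert u S) v).card = (nbr G S v).card + 1 :=
    fun v hv => card_nbr_insert hu (mem_nbr.1 hv).2.symm
  have hfree : ∀ v, Fintype.card C ≤ (used G S f g v)ᶜ.card + (nbr G S v).card + 1 :=
    card_compl_used
  suffices ∃ k : V → C, (∀ v ∈ nbr G S u, ∀ w ∈ nbr G S u, v ≠ w → k v ≠ k w) ∧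
      ∀ v ∈ nbr G S u, k v ∉ used G S f g v by
    obtain ⟨k, hk, hk'⟩ := this
    obtain ⟨f', g', h', -⟩ := h.extend_of_card_le_two hu (by omega) hdeg k hk hk'
    exact ⟨f', g', h'⟩
  have hone : ∀ v ∈ nbr G S u, ∃ c, c ∉ used G S f g v := by
    intro v hv
    have h1 : 0 < (used G S f g v)ᶜ.card := by
      have := hfree v
      have := hcard v hv
      have := hmax v
      omega
    obtain ⟨c, hc⟩ := Finset.card_pos.1 h1
    exact ⟨c, Finset.mem_compl.1 hc⟩
  by_cases h2 : (nbr G S u).card = 2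
  · obtain ⟨v, hv, hvK⟩ := hred h2
    obtain ⟨w, hw, hwv⟩ := Finset.exists_mem_ne (s := nbr G S u) (by omega) v
    have hN : nbr G S u = {v, w} := by
      symm
      refine Finset.eq_of_subset_of_card_le ?_ ?_
      · intro x hx
        simp only [Finset.mem_insert, Finset.mem_singleton] at hx
        rcases hx with rfl | rfl <;> assumption
      · rw [h2, Finset.card_pair hwv.symm]
    obtain ⟨c, hc⟩ := hone w hw
    -- In `S` the degree of `v` is at most `K - 2`, so two colors are free there and one of them
    -- differs from `c`.
    obtain ⟨d, hd, hdc⟩ := Finset.exists_mem_ne (s := (used G S f g v)ᶜ) (by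
      have := hfree v
      have := hcard v hv
      omega) c
    rw [Finset.mem_compl] at hd
    refine ⟨fun x => if x = v then d else c, ?_, ?_⟩ <;> rw [hN] <;>
      simp only [Finset.mem_insert, Finset.mem_singleton] <;> grind
  · have h1 : (nbr G S u).card ≤ 1 := by omega
    rw [Finset.card_le_one] at h1
    rcases (nbr G S u).eq_empty_or_nonempty with he | ⟨v, hv⟩
    · obtain ⟨c⟩ : Nonempty C := Fintype.card_pos_iff.1 (by omega)
      exact ⟨fun _ => c, by simp [he]⟩
    · obtain ⟨c, hc⟩ := hone v hv
      refine ⟨fun _ => c, fun x hx y hy hxy => absurd (h1 x hx y hy) hxy, fun x hx => ?_⟩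
      rwa [h1 x hx v hv]

end Coloring

/-! ### Reducible configurations -/

section Reducible

open scoped Classical

variable {V C : Type*} {G : SimpleGraph V} {S : Finset V}

/-- Distinct representatives for three lists of size at least two, not all equal. -/
theorem exists_distinct_representatives {X Y Z : Finset C} (hX : 2 ≤ X.card) (hY : 2 ≤ Y.card)
    (h : ∃ z ∈ Z, z ∉ X ∨ z ∉ Y) : ∃ x ∈ X, ∃ y ∈ Y, ∃ z ∈ Z,
      x ≠ y ∧ x ≠ z ∧ y ≠ z := by
  obtain ⟨z, hz, hz' | hz'⟩ := h
  · obtain ⟨y, hy, hyz⟩ := Finset.exists_mem_ne (s := Y) (by omega) z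
    obtain ⟨x, hx, hxy⟩ := Finset.exists_mem_ne (s := X) (by omega) y
    exact ⟨x, hx, y, hy, z, hz, hxy, fun e => hz' (e ▸ hx), hyz⟩
  · obtain ⟨x, hx, hxz⟩ := Finset.exists_mem_ne (s := X) (by omega) z
    obtain ⟨y, hy, hyx⟩ := Finset.exists_mem_ne (s := Y) (by omega) x
    exact ⟨x, hx, y, hy, z, hz, hyx.symm, hxz, fun e => hz' (e ▸ hy)⟩

/-- Colors of a four-cycle `abdc` from lists at `a` and `d`. -/
theorem exists_four_cycle_colors {A D : Finset C} (hA : 2 ≤ A.card) (hD : 2 ≤ D.card) :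
    ∃ ab ∈ A, ∃ ac ∈ A, ∃ db ∈ D, ∃ dc ∈ D, ab ≠ ac ∧ db ≠ dc ∧ ab ≠ db ∧ ac ≠ dc := by
  obtain ⟨x, hx, y, hy, hxy⟩ := Finset.one_lt_card.1 (show 1 < A.card by omega)
  obtain ⟨z, hz, w, hw, hzw⟩ := Finset.one_lt_card.1 (show 1 < D.card by omega)
  by_cases h : x ≠ z ∧ y ≠ w
  · exact ⟨x, hx, y, hy, z, hz, w, hw, hxy, hzw, h.1, h.2⟩
  · exact ⟨x, hx, y, hy, w, hw, z, hz, hxy, hzw.symm, by grind, by grind⟩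

/-- The colors belong to a path of edges, in the order `p, x, x', y, y', r`. Only `p` can force the
order of the two colors from `X`, and then `x' = p`; likewise `r` can only force `y = r`. If both
orders are forced, `p ≠ r` gives `x' ≠ y`; otherwise a free order can be chosen to achieve this. -/
theorem exists_ear_colors {X Y : Finset C} (hX : 2 ≤ X.card) (hY : 2 ≤ Y.card) {p r : C}
    (hpr : p ≠ r) : ∃ x ∈ X, ∃ x' ∈ X, ∃ y ∈ Y, ∃ y' ∈ Y,
      x ≠ x' ∧ y ≠ y' ∧ x ≠ p ∧ x' ≠ y ∧ y' ≠ r := by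
  obtain ⟨x, hx, x', hx', hxx⟩ := Finset.one_lt_card.1 (show 1 < X.card by omega)
  obtain ⟨y, hy, y', hy', hyy⟩ := Finset.one_lt_card.1 (show 1 < Y.card by omega)
  by_cases h1 : x ≠ p ∧ x' ≠ y ∧ y' ≠ r
  · exact ⟨x, hx, x', hx', y, hy, y', hy', by grind⟩
  by_cases h2 : x' ≠ p ∧ x ≠ y ∧ y' ≠ r
  · exact ⟨x', hx', x, hx, y, hy, y', hy', by grind⟩
  by_cases h3 : x ≠ p ∧ x' ≠ y' ∧ y ≠ r
  · exact ⟨x, hx, x', hx', y', hy', y, hy, by grind⟩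
  · exact ⟨x', hx', x, hx, y', hy', y, hy, by grind⟩

variable [Fintype C]

/-- Colors of two adjacent vertices `b`, `c`, of the edge `bc`, and of the edges from `b` and `c`
to vertices `a` and `d` that are colored `α` and `δ`. -/
theorem exists_twin_colors (hC : 6 ≤ Fintype.card C) (α δ : C) {A D : Finset C}
    (hA : 2 ≤ A.card) (hD : 2 ≤ D.card) :
    ∃ ab ∈ A, ∃ ac ∈ A, ∃ db ∈ D, ∃ dc ∈ D, ∃ b c e : C,
      (ab ≠ ac ∧ db ≠ dc ∧ ab ≠ db ∧ ac ≠ dc) ∧ e ∉ ({ab, ac, db, dc} : Finset C) ∧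
      b ∉ ({ab, db, α, δ} : Finset C) ∧ c ∉ ({ac, dc, α, δ} : Finset C) ∧
      b ≠ c ∧ b ≠ e ∧ c ≠ e := by
  obtain ⟨ab, hab, ac, hac, db, hdb, dc, hdc, hne⟩ := exists_four_cycle_colors hA hD
  refine ⟨ab, hab, ac, hac, db, hdb, dc, hdc, ?_⟩
  have hcard : ∀ x y z w : C, 2 ≤ (({x, y, z, w} : Finset C)ᶜ).card := by
    intro x y z w
    have := Finset.card_le_four (a := x) (b := y) (c := z) (d := w)
    rw [Finset.card_compl]
    omega
  have hE := hcard ab ac db dc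
  have hB := hcard ab db α δ
  have hY := hcard ac dc α δ
  simp only [← Finset.mem_compl]
  -- The colors allowed for `e`, `b` and `c` form three lists of size at least two, which have
  -- distinct representatives unless all three lists are equal.
  by_cases h : ∃ e ∈ ({ab, ac, db, dc} : Finset C)ᶜ,
      e ∉ ({ab, db, α, δ} : Finset C)ᶜ ∨ e ∉ ({ac, dc, α, δ} : Finset C)ᶜ
  · obtain ⟨b, hb, c, hc, e, he, h1, h2, h3⟩ := exists_distinct_representatives hB hY h
    exact ⟨b, c, e, hne, he, hb, hc, h1, h2, h3⟩
  by_cases h' : ∃ b ∈ ({ab, db, α, δ} : Finset C)ᶜ,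
      b ∉ ({ab, ac, db, dc} : Finset C)ᶜ ∨ b ∉ ({ac, dc, α, δ} : Finset C)ᶜ
  · obtain ⟨e, he, c, hc, b, hb, h1, h2, h3⟩ := exists_distinct_representatives hE hY h'
    exact ⟨b, c, e, hne, he, hb, hc, h3.symm, h2.symm, h1.symm⟩
  by_cases h'' : ∃ c ∈ ({ac, dc, α, δ} : Finset C)ᶜ,
      c ∉ ({ab, ac, db, dc} : Finset C)ᶜ ∨ c ∉ ({ab, db, α, δ} : Finset C)ᶜ
  · obtain ⟨e, he, b, hb, c, hc, h1, h2, h3⟩ := exists_distinct_representatives hE hB h''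
    exact ⟨b, c, e, hne, he, hb, hc, h3, h1.symm, h2.symm⟩
  push Not at h h' h''
  simp only [Finset.mem_compl, Finset.mem_insert, Finset.mem_singleton] at h h' h''
  -- With equal lists and four distinct edge colors, `{α, δ}` would be both `{ac, dc}` and `{ab,
  -- db}`. So an edge color repeats, and the common list has a third element.
  have heq : ab = dc ∨ ac = db := by
    have h1 := h' ac
    have h2 := h' dc
    have h3 := h'' ab
    have h4 := h'' db
    grind
  have hlarge : 2 < (({ab, ac, db, dc} : Finset C)ᶜ).card := by
    have hle : ({ab, ac, db, dc} : Finset C).card ≤ 3 := by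
      rcases heq with rfl | rfl
      · rw [show ({ab, ac, db, ab} : Finset C) = {ab, ac, db} by grind]
        exact Finset.card_le_three
      · rw [show ({ab, ac, ac, dc} : Finset C) = {ab, ac, dc} by grind]
        exact Finset.card_le_three
    rw [Finset.card_compl]
    omega
  obtain ⟨b, hb, c, hc, e, he, hbc, hbe, hce⟩ := Finset.two_lt_card.1 hlarge
  refine ⟨b, c, e, hne, he, ?_, ?_, hbc, hbe, hce⟩
  · have := h b
    simp only [Finset.mem_compl, Finset.mem_insert, Finset.mem_singleton] at hb ⊢
    exact (this hb).1
  · have := h c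
    simp only [Finset.mem_compl, Finset.mem_insert, Finset.mem_singleton] at hc ⊢
    exact (this hc).2

/-- Two adjacent new vertices `b` and `c` whose other neighbors are `a` and `d`. -/
theorem ColoringOn.extend_twins {f : V → C} {g : V → V → C} (h : ColoringOn G S f g)
    (hC : 6 ≤ Fintype.card C) {a b c d : V} (hb : b ∉ S) (hc : c ∉ S) (had : a ≠ d)
    (hbc : G.Adj b c) (hNb : nbr G S b = {a, d}) (hNc : nbr G S c = {a, d})
    {A D : Finset C} (hA : 2 ≤ A.card) (hD : 2 ≤ D.card)
    (hAu : Disjoint A (used G S f g a)) (hDu : Disjoint D (used G S f g d)) :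
    ∃ (f' : V → C) (g' : V → V → C), ColoringOn G (insert c (insert b S)) f' g' ∧
      (∃ ab ∈ A, ∃ ac ∈ A, used G (insert c (insert b S)) f' g' a =
        insert ac (insert ab (used G S f g a))) ∧
      (∃ db ∈ D, ∃ dc ∈ D, used G (insert c (insert b S)) f' g' d =
        insert dc (insert db (used G S f g d))) ∧
      (used G (insert c (insert b S)) f' g' b).card ≤ 4 ∧
      (used G (insert c (insert b S)) f' g' c).card ≤ 4 := by
  obtain ⟨ab, hab, ac, hac, db, hdb, dc, hdc, β, κ, e, ⟨n1, n2, n3, n4⟩, he, hβ, hκ, m1, m2, m3⟩ :=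
    exists_twin_colors hC (f a) (f d) hA hD
  rw [Finset.disjoint_left] at hAu hDu
  have haS : a ∈ S := (mem_nbr.1 (hNb ▸ Finset.mem_insert_self a {d} : a ∈ nbr G S b)).1
  have hdS : d ∈ S := (mem_nbr.1 (hNb ▸ by simp : d ∈ nbr G S b)).1
  have hba : b ≠ a := fun e => hb (e ▸ haS)
  have hbd : b ≠ d := fun e => hb (e ▸ hdS)
  have hcb : c ≠ b := hbc.ne'
  simp only [Finset.mem_insert, Finset.mem_singleton, not_or] at he hβ hκ
  obtain ⟨f₁, g₁, h₁, hf₁, hf₁b, hu₁, -, hu₁b⟩ := h.extend hb β (fun x => if x = a then ab else db)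
    (by
      rw [hNb]
      simp only [Finset.mem_insert, Finset.mem_singleton]
      grind) (by
      rw [hNb]
      simp only [Finset.mem_insert, Finset.mem_singleton]
      grind) (by
      rw [hNb]
      simp only [Finset.mem_insert, Finset.mem_singleton]
      grind) (by
      rw [hNb]
      simp only [Finset.mem_insert, Finset.mem_singleton]
      grind)
  rw [hNb] at hu₁ hu₁b
  have hua := hu₁ a (by simp)
  have hud := hu₁ d (by simp)
  simp only [if_pos, if_neg had.symm] at hua hud
  have hub : used G (insert b S) f₁ g₁ b = {β, ab, db} := by
    rw [hu₁b]
    simp [Finset.image_insert, had.symm]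
  have hNc' : nbr G (insert b S) c = {b, a, d} := by rw [nbr_insert_of_adj hbc.symm, hNc]
  obtain ⟨f₂, g₂, h₂, -, -, hu₂, -, hu₂c⟩ := h₁.extend (u := c) (by simp [hcb, hc]) κ
    (fun x => if x = b then e else if x = a then ac else dc)
    (by
      rw [hNc']
      simp only [Finset.mem_insert, Finset.mem_singleton]
      grind) (by
      rw [hNc']
      simp only [Finset.mem_insert, Finset.mem_singleton]
      rintro v (rfl | rfl | rfl)
      · rw [hub]
        simp [he, m2.symm]
      · rw [hua]
        simp [hba.symm, n1.symm, hAu hac]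
      · rw [hud]
        simp [hbd.symm, had.symm, n2.symm, hDu hdc]) (by
      rw [hNc']
      simp only [Finset.mem_insert, Finset.mem_singleton]
      rintro v (rfl | rfl | rfl)
      · rw [hf₁b]
        exact m1.symm
      · rw [hf₁ _ haS]
        exact hκ.2.2.1
      · rw [hf₁ _ hdS]
        exact hκ.2.2.2) (by
      rw [hNc']
      simp only [Finset.mem_insert, Finset.mem_singleton]
      grind)
  rw [hNc'] at hu₂ hu₂c
  refine ⟨f₂, g₂, h₂, ⟨ab, hab, ac, hac, ?_⟩, ⟨db, hdb, dc, hdc, ?_⟩, ?_, ?_⟩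
  · rw [hu₂ a (by simp), hua]
    simp [hba.symm]
  · rw [hu₂ d (by simp), hud]
    simp [hbd.symm, had.symm]
  · rw [hu₂ b (by simp), hub]
    exact Finset.card_le_four
  · rw [hu₂c]
    refine (Finset.card_insert_le _ _).trans (Nat.succ_le_succ ?_)
    exact Finset.card_image_le.trans Finset.card_le_three

/-- Two new vertices with the same two old neighbors. -/
theorem ColorableOn.insert_twins {K : ℕ} (h : ColorableOn G C S) (hK : 5 ≤ K)
    (hC : Fintype.card C = K + 1) {a b c d : V} (hb : b ∉ S) (hc : c ∉ S) (hbc : b ≠ c)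
    (had : a ≠ d) (hmax : ∀ v, (nbr G (insert c (insert b S)) v).card ≤ K)
    (hNb : nbr G S b = {a, d}) (hNc : nbr G S c = {a, d}) :
    ColorableOn G C (insert c (insert b S)) := by
  obtain ⟨f, g, h⟩ := h
  have ha := mem_nbr.1 (hNb ▸ Finset.mem_insert_self a {d} : a ∈ nbr G S b)
  have hd := mem_nbr.1 (hNb ▸ by simp : d ∈ nbr G S b)
  have ha' := mem_nbr.1 (hNc ▸ Finset.mem_insert_self a {d} : a ∈ nbr G S c)
  have hd' := mem_nbr.1 (hNc ▸ by simp : d ∈ nbr G S c)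
  have hc' : c ∉ insert b S := by simp [hbc.symm, hc]
  have hfree : ∀ v, G.Adj b v → G.Adj c v → 2 ≤ (used G S f g v)ᶜ.card := by
    intro v hv hv'
    have h1 := hmax v
    rw [card_nbr_insert hc' hv'.symm, card_nbr_insert hb hv.symm] at h1
    have h2 := card_compl_used (G := G) (S := S) (f := f) (g := g) v
    omega
  have hA := hfree a ha.2 ha'.2
  have hD := hfree d hd.2 hd'.2
  by_cases hadj : G.Adj b c
  · obtain ⟨f', g', h', -⟩ := h.extend_twins (by omega) hb hc had hadj hNb hNc hA hD
      disjoint_compl_left disjoint_compl_left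
    exact ⟨f', g', h'⟩
  -- Without the edge `bc`, the new edges form a four-cycle, and `b` and `c` have degree two, so
  -- their own colors cause no difficulty.
  · obtain ⟨ab, hab, ac, hac, db, hdb, dc, hdc, n1, n2, n3, n4⟩ := exists_four_cycle_colors hA hD
    rw [Finset.mem_compl] at hab hac hdb hdc
    obtain ⟨f₁, g₁, h₁, hu₁, -⟩ := h.extend_of_card_le_two hb (by omega)
      (by rw [hNb]; exact Finset.card_le_two) (fun x => if x = a then ab else db)
      (by
        rw [hNb]
        simp only [Finset.mem_insert, Finset.mem_singleton]
        grind) (by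
        rw [hNb]
        simp only [Finset.mem_insert, Finset.mem_singleton]
        grind)
    rw [hNb] at hu₁
    have hNc' : nbr G (insert b S) c = {a, d} := by
      rw [nbr_insert_of_not_adj fun e => hadj e.symm, hNc]
    have hua := hu₁ a (by simp)
    have hud := hu₁ d (by simp)
    simp only [if_pos, if_neg had.symm] at hua hud
    obtain ⟨f₂, g₂, h₂, -⟩ := h₁.extend_of_card_le_two hc' (by omega)
      (by rw [hNc']; exact Finset.card_le_two) (fun x => if x = a then ac else dc)
      (by
        rw [hNc']
        simp only [Finset.mem_insert, Finset.mem_singleton]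
        grind) (by
        rw [hNc']
        simp only [Finset.mem_insert, Finset.mem_singleton]
        grind)
    exact ⟨f₂, g₂, h₂⟩

/-- Two adjacent new vertices `b`, `c` with old neighbors `a`, `d`, and three vertices of degree
two attached to the edges of the path `abcd`. -/
theorem ColorableOn.insert_twins_with_ears (h : ColorableOn G C S) (hC : Fintype.card C = 6)
    {a b c d p q r : V} (hb : b ∉ S) (hc : c ∉ S) (had : a ≠ d) (hbc : G.Adj b c)
    (hNb : nbr G S b = {a, d}) (hNc : nbr G S c = {a, d}) (hda : (nbr G S a).card ≤ 2)
    (hdd : (nbr G S d).card ≤ 2) (hp : p ∉ insert c (insert b S))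
    (hq : q ∉ insert p (insert c (insert b S)))
    (hr : r ∉ insert q (insert p (insert c (insert b S))))
    (hNp : nbr G (insert c (insert b S)) p = {a, b})
    (hNq : nbr G (insert p (insert c (insert b S))) q = {b, c})
    (hNr : nbr G (insert q (insert p (insert c (insert b S)))) r = {c, d}) :
    ColorableOn G C (insert r (insert q (insert p (insert c (insert b S))))) := by
  obtain ⟨f, g, h⟩ := h
  have haS : a ∈ S := (mem_nbr.1 (hNb ▸ Finset.mem_insert_self a {d} : a ∈ nbr G S b)).1
  have hdS : d ∈ S := (mem_nbr.1 (hNb ▸ by simp : d ∈ nbr G S b)).1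
  have hab : a ≠ b := fun e => hb (e ▸ haS)
  have hac : a ≠ c := fun e => hc (e ▸ haS)
  have hdb : d ≠ b := fun e => hb (e ▸ hdS)
  have hdc : d ≠ c := fun e => hc (e ▸ hdS)
  have hcb : c ≠ b := hbc.ne'
  have hA : 3 ≤ (used G S f g a)ᶜ.card := by
    have := card_compl_used (G := G) (S := S) (f := f) (g := g) a
    omega
  have hD : 3 ≤ (used G S f g d)ᶜ.card := by
    have := card_compl_used (G := G) (S := S) (f := f) (g := g) d
    omega
  -- The colors of the outer ear edges `ap` and `dr` are reserved beforehand. They are taken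
  -- different, as `exists_ear_colors` requires, and leave two free colors at each of `a` and `d`
  -- for the twins.
  obtain ⟨ap, hap⟩ := Finset.card_pos.1 (show 0 < (used G S f g a)ᶜ.card by omega)
  obtain ⟨dr, hdr, hpr⟩ := Finset.exists_mem_ne (show 1 < (used G S f g d)ᶜ.card by omega) ap
  obtain ⟨f₁, g₁, h₁, ⟨ab, hab', ac, hac', hua⟩, ⟨db, hdb', dc, hdc', hud⟩, hub, huc⟩ :=
    h.extend_twins (by omega) hb hc had hbc hNb hNc
    (A := (used G S f g a)ᶜ.erase ap) (D := (used G S f g d)ᶜ.erase dr)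
    (by rw [Finset.card_erase_of_mem hap]; omega) (by rw [Finset.card_erase_of_mem hdr]; omega)
    (disjoint_compl_left.mono_left (Finset.erase_subset _ _))
    (disjoint_compl_left.mono_left (Finset.erase_subset _ _))
  rw [Finset.mem_erase] at hab' hac' hdb' hdc'
  rw [Finset.mem_compl] at hap hdr
  generalize hT : insert c (insert b S) = T at *
  have haT : a ∈ T := by simp [← hT, haS]
  have hbT : b ∈ T := by simp [← hT]
  have hcT : c ∈ T := by simp [← hT]
  have hdT : d ∈ T := by simp [← hT, hdS]
  have hpT : ∀ v ∈ T, v ≠ p := fun v hv e => hp (e ▸ hv)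
  -- At `b` and `c` four of the six colors may be used. The colors `x`, `x'`, `y`, `y'` are for the
  -- edges `bp`, `bq`, `cq`, `cr`.
  obtain ⟨x, hx, x', hx', y, hy, y', hy', hxx, hyy, hxp, hxy, hyr⟩ :=
    exists_ear_colors (X := (used G T f₁ g₁ b)ᶜ) (Y := (used G T f₁ g₁ c)ᶜ)
    (by rw [Finset.card_compl]; omega) (by rw [Finset.card_compl]; omega) hpr.symm
  rw [Finset.mem_compl] at hx hx' hy hy'
  have hap₁ : ap ∉ used G T f₁ g₁ a := by
    rw [hua]
    simp [hap, hab'.1.symm, hac'.1.symm]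
  have hdr₁ : dr ∉ used G T f₁ g₁ d := by
    rw [hud]
    simp [hdr, hdb'.1.symm, hdc'.1.symm]
  obtain ⟨f₂, g₂, h₂, hu₂, hv₂⟩ := h₁.extend_of_card_le_two hp (by omega)
    (by rw [hNp]; exact Finset.card_le_two) (fun v => if v = a then ap else x)
    (by
      rw [hNp]
      simp only [Finset.mem_insert, Finset.mem_singleton]
      grind) (by
      rw [hNp]
      simp only [Finset.mem_insert, Finset.mem_singleton]
      grind)
  rw [hNp] at hu₂ hv₂
  have hub₂ := hu₂ b (by simp)
  have huc₂ := hv₂ c hcT (by simp [hac.symm, hcb])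
  have hud₂ := hv₂ d hdT (by simp [had.symm, hdb])
  simp only [if_neg hab.symm] at hub₂
  obtain ⟨f₃, g₃, h₃, hu₃, hv₃⟩ := h₂.extend_of_card_le_two hq (by omega)
    (by rw [hNq]; exact Finset.card_le_two) (fun v => if v = b then x' else y)
    (by
      rw [hNq]
      simp only [Finset.mem_insert, Finset.mem_singleton]
      grind) (by
      rw [hNq]
      simp only [Finset.mem_insert, Finset.mem_singleton]
      grind)
  rw [hNq] at hu₃ hv₃
  have huc₃ := hu₃ c (by simp)
  have hud₃ := hv₃ d (by simp [hdT]) (by simp [hdb, hdc])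
  simp only [if_neg hcb] at huc₃
  obtain ⟨f₄, g₄, h₄, -⟩ := h₃.extend_of_card_le_two hr (by omega)
    (by rw [hNr]; exact Finset.card_le_two) (fun v => if v = c then y' else dr)
    (by
      rw [hNr]
      simp only [Finset.mem_insert, Finset.mem_singleton]
      grind) (by
      rw [hNr]
      simp only [Finset.mem_insert, Finset.mem_singleton]
      grind)
  exact ⟨f₄, g₄, h₄⟩

end Reducible

/-! ### Unavoidable configurations -/

section Structure

variable {V : Type*} [LinearOrder V] {G : SimpleGraph V} {S : Finset V}

/-- The vertices of `S` strictly between `x` and `y`. -/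
def inside (S : Finset V) (x y : V) : Finset V := S.filter fun t => x < t ∧ t < y

/-- No edge joins a vertex between `x` and `y` to a vertex beyond them. -/
def Clean (G : SimpleGraph V) (S : Finset V) (x y : V) : Prop :=
  ∀ s ∈ S, ∀ t ∈ S, x < s → s < y → G.Adj s t → x ≤ t ∧ t ≤ y

@[simp] theorem mem_inside {x y t : V} : t ∈ inside S x y ↔ t ∈ S ∧ x < t ∧ t < y := by
  simp [inside]

/-- Consider the last neighbor `w` of `x` inside the interval. If no edge passes over `w` from
between `x` and `w`, cut at `w`. Otherwise such an edge `zt` crosses `xw`, and neither of the two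
crosses anything else: cut at `t` if `t < y`, and at both `z` and `w` if `t = y`. If `x` has no
neighbor inside, cut at the first interior vertex. -/
theorem Clean.dissect (hG : SingleCrossing G) {x y : V} (hy : y ∈ S)
    (hxy : Clean G S x y) (hne : (inside S x y).Nonempty) :
    (∃ z ∈ S, x < z ∧ z < y ∧ Clean G S x z ∧ Clean G S z y) ∨
    ∃ z ∈ S, ∃ w ∈ S, x < z ∧ z < w ∧ w < y ∧ G.Adj x w ∧ G.Adj z y ∧
      Clean G S x z ∧ Clean G S z w ∧ Clean G S w y := by
  by_cases hN : ((inside S x y).filter (G.Adj x)).Nonempty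
  · obtain ⟨w, hw, hmax⟩ := Finset.exists_max_image _ id hN
    simp only [id, Finset.mem_filter, mem_inside] at hw hmax
    obtain ⟨⟨hwS, hxw, hwy⟩, hadj⟩ := hw
    by_cases hcr : ∃ z ∈ S, ∃ t ∈ S, G.Adj z t ∧ x < z ∧ z < w ∧ w < t
    · obtain ⟨z, hz, t, ht, hzt, hxz, hzw, hwt⟩ := hcr
      have hty : t ≤ y := (hxy z hz t ht hxz (hzw.trans hwy) hzt).2
      have h1 : ∀ s u, G.Adj s u → Interleave x w s u → s = z ∧ u = t := fun s u hsu hi =>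
        hG x w s u z t hadj hsu hzt hi (Or.inl ⟨hxz, hzw, hwt⟩)
      have h2 : ∀ s u, G.Adj s u → Interleave z t s u → s = x ∧ u = w := fun s u hsu hi =>
        hG z t s u x w hzt hsu hadj hi (Or.inr ⟨hxz, hzw, hwt⟩)
      simp only [Interleave] at h1 h2
      rcases hty.lt_or_eq with hlt | rfl
      · left
        refine ⟨t, ht, by order, hlt, ?_, ?_⟩
        · intro s hs u hu hxs hst hsu
          have c := hxy s hs u hu hxs (by order) hsu
          have a1 := h1 s u hsu
          have a2 := h1 u s hsu.symm
          have a3 := h2 s u hsu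
          have a4 := h2 u s hsu.symm
          refine ⟨c.1, ?_⟩
          by_contra hcon
          rcases lt_or_ge s w with hsw | hsw
          · grind
          · grind
        · intro s hs u hu hts hsy hsu
          have c := hxy s hs u hu (by order) hsy hsu
          have a2 := h1 u s hsu.symm
          have a4 := h2 u s hsu.symm
          refine ⟨?_, c.2⟩
          by_contra hcon
          rcases c.1.lt_or_eq with hxu | rfl
          · rcases lt_or_ge u w with huw | hwu
            · exact hts.ne' (a2 (Or.inl ⟨hxu, huw, by order⟩)).2
            · exact hxu.ne' (a4 (Or.inl ⟨by order, by order, hts⟩)).1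
          · have := hmax s ⟨⟨hs, by order, hsy⟩, hsu.symm⟩
            order
      · right
        refine ⟨z, hz, w, hwS, hxz, hzw, hwy, hadj, hzt, ?_, ?_, ?_⟩
        · intro s hs u hu hxs hsz hsu
          have c := hxy s hs u hu hxs (by order) hsu
          have a1 := h1 s u hsu
          have a3 := h2 s u hsu
          refine ⟨c.1, ?_⟩
          by_contra hcon
          rcases lt_or_ge w u with hwu | huw
          · exact hsz.ne (a1 (Or.inl ⟨hxs, by order, hwu⟩)).1
          · exact hxs.ne' (a3 (Or.inr ⟨hsz, by order, by order⟩)).1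
        · intro s hs u hu hzs hsw hsu
          have c := hxy s hs u hu (by order) (by order) hsu
          have a1 := h1 s u hsu
          have a2 := h1 u s hsu.symm
          have a3 := h2 s u hsu
          have a4 := h2 u s hsu.symm
          constructor
          · by_contra hcon
            grind
          · by_contra hcon
            grind
        · intro s hs u hu hws hsy hsu
          have c := hxy s hs u hu (by order) hsy hsu
          have a2 := h1 u s hsu.symm
          refine ⟨?_, c.2⟩
          by_contra hcon
          rcases c.1.lt_or_eq with hxu | rfl
          · exact hsy.ne (a2 (Or.inl ⟨hxu, by order, hws⟩)).2
          · have := hmax s ⟨⟨hs, by order, hsy⟩, hsu.symm⟩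
            order
    · left
      push Not at hcr
      refine ⟨w, hwS, hxw, hwy, ?_, ?_⟩
      · intro s hs u hu hxs hsw hsu
        exact ⟨(hxy s hs u hu hxs (by order) hsu).1, hcr s hs u hu hsu hxs hsw⟩
      · intro s hs u hu hws hsy hsu
        have c := hxy s hs u hu (by order) hsy hsu
        refine ⟨?_, c.2⟩
        by_contra hcon
        have := hcr u hu s hs hsu.symm
        have m := hmax s
        have := hsu.symm
        grind
  · obtain ⟨w, hw, hmin⟩ := Finset.exists_min_image _ id hne
    simp only [id, mem_inside] at hw hmin
    obtain ⟨hwS, hxw, hwy⟩ := hw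
    left
    refine ⟨w, hwS, hxw, hwy, fun s hs u hu hxs hsw => ?_, fun s hs u hu hws hsy hsu => ?_⟩
    · exact absurd (hmin s ⟨hs, hxs, by order⟩) (by order)
    · have c := hxy s hs u hu (by order) hsy hsu
      refine ⟨?_, c.2⟩
      by_contra hcon
      rcases c.1.lt_or_eq with hlt | rfl
      · exact hcon (hmin u ⟨hu, hlt, by order⟩)
      · exact hN ⟨s, by simpa [hs, hsu.symm, hsy] using by order⟩

/-- A vertex of degree at most one, or a vertex of degree two with a neighbor of degree less than
`K`. -/
def HasLowVertex {V : Type*} (G : SimpleGraph V) (S : Finset V) (K : ℕ) : Prop :=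
  ∃ u ∈ S, (nbr G S u).card ≤ 2 ∧
    ((nbr G S u).card = 2 → ∃ v ∈ nbr G S u, (nbr G S v).card < K)

/-- Two vertices of degree two or three that are adjacent to the same two other vertices. -/
def HasTwins {V : Type*} (G : SimpleGraph V) (S : Finset V) : Prop :=
  ∃ a d, ∃ b ∈ S, ∃ c ∈ S, a ≠ d ∧ b ≠ c ∧ (∀ t, t ∈ nbr G S b ∧ t ≠ c ↔ t = a ∨ t = d) ∧
    ∀ t, t ∈ nbr G S c ∧ t ≠ b ↔ t = a ∨ t = d

/-- Adjacent vertices `b`, `c` with common neighbors `a`, `d`, and vertices of degree two attached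
to the edges of the path `abcd`. -/
def HasTwinsWithEars {V : Type*} (G : SimpleGraph V) (S : Finset V) : Prop :=
  ∃ a p b q c r d, [a, p, b, q, c, r, d].Nodup ∧ b ∈ S ∧ c ∈ S ∧ p ∈ S ∧ q ∈ S ∧ r ∈ S ∧
    (∀ t, t ∈ nbr G S p ↔ t = a ∨ t = b) ∧ (∀ t, t ∈ nbr G S q ↔ t = b ∨ t = c) ∧
    (∀ t, t ∈ nbr G S r ↔ t = c ∨ t = d) ∧
    (∀ t, t ∈ nbr G S b ↔ t = a ∨ t = c ∨ t = d ∨ t = p ∨ t = q) ∧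
    ∀ t, t ∈ nbr G S c ↔ t = a ∨ t = b ∨ t = d ∨ t = q ∨ t = r

theorem le_card_of_not_hasLowVertex {V : Type*} {G : SimpleGraph V} {S : Finset V} {K : ℕ}
    (hlow : ¬ HasLowVertex G S K) {u v : V} (hu : u ∈ S) (hdeg : (nbr G S u).card ≤ 2)
    (hv : v ∈ nbr G S u) :
    (nbr G S u).card = 2 ∧ K ≤ (nbr G S v).card := by
  by_contra hcon
  refine hlow ⟨u, hu, hdeg, fun h2 => ⟨v, hv, ?_⟩⟩
  by_contra hge
  exact hcon ⟨h2, by omega⟩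

/-- All neighbors of the only interior vertex are ends of the interval. Unless it has degree two and
both ends have degree at least `K`, it is a low vertex. -/
theorem Clean.exists_ear {K : ℕ} (hlow : ¬ HasLowVertex G S K) {x y : V} (hxy : Clean G S x y)
    (h1 : (inside S x y).card = 1) : ∃ u ∈ S, x < u ∧ u < y ∧ inside S x y = {u} ∧
      nbr G S u = {x, y} ∧ K ≤ (nbr G S x).card ∧ K ≤ (nbr G S y).card := by
  obtain ⟨u, hu⟩ := Finset.card_eq_one.1 h1
  have hmem : u ∈ inside S x y := hu ▸ Finset.mem_singleton_self u
  rw [mem_inside] at hmem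
  have hsub : nbr G S u ⊆ {x, y} := by
    intro t ht
    rw [mem_nbr] at ht
    have hc := hxy u hmem.1 t ht.1 hmem.2.1 hmem.2.2 ht.2
    by_contra hcon
    simp only [Finset.mem_insert, Finset.mem_singleton, not_or] at hcon
    have : t ∈ inside S x y :=
      mem_inside.2 ⟨ht.1, lt_of_le_of_ne hc.1 (Ne.symm hcon.1), lt_of_le_of_ne hc.2 hcon.2⟩
    rw [hu, Finset.mem_singleton] at this
    exact ht.2.ne this.symm
  have hcard : (nbr G S u).card ≤ 2 := (Finset.card_le_card hsub).trans Finset.card_le_two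
  have h2 : (nbr G S u).card = 2 := by
    by_contra hne
    exact hlow ⟨u, hmem.1, hcard, fun h => absurd h hne⟩
  have heq : nbr G S u = {x, y} :=
    Finset.eq_of_subset_of_card_le hsub (h2 ▸ Finset.card_le_two)
  exact ⟨u, hmem.1, hmem.2.1, hmem.2.2, hu, heq,
    (le_card_of_not_hasLowVertex hlow hmem.1 hcard (heq ▸ Finset.mem_insert_self x {y})).2,
    (le_card_of_not_hasLowVertex hlow hmem.1 hcard (heq ▸ by simp)).2⟩

/-- Without the neighbor `x`, the vertex `z` would have degree at most two and be low: if the degree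
is two, `w` is a neighbor of degree at most `3 < K`. -/
theorem mem_nbr_of_not_hasLowVertex {K : ℕ} (hK : 5 ≤ K) (hlow : ¬ HasLowVertex G S K)
    {x y z w : V} (hz : z ∈ S) (hNz : ∀ t ∈ nbr G S z, t = x ∨ t = w ∨ t = y)
    (hw : (nbr G S w).card ≤ 3) : x ∈ nbr G S z := by
  by_contra hx
  have hsub : nbr G S z ⊆ {w, y} := by
    intro t ht
    rcases hNz t ht with rfl | h
    · exact absurd ht hx
    · simpa using h
  have hcard := (Finset.card_le_card hsub).trans Finset.card_le_two
  have h2 : (nbr G S z).card = 2 := by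
    by_contra hne
    exact hlow ⟨z, hz, hcard, fun h => absurd h hne⟩
  have heq : nbr G S z = {w, y} :=
    Finset.eq_of_subset_of_card_le hsub (h2 ▸ Finset.card_le_two)
  have := (le_card_of_not_hasLowVertex hlow hz hcard (heq ▸ Finset.mem_insert_self w {y})).2
  omega

theorem hasTwins_of_not_hasLowVertex {K : ℕ} (hK : 5 ≤ K) (hlow : ¬ HasLowVertex G S K)
    {x y z w : V} (hz : z ∈ S) (hw : w ∈ S) (hxy : x ≠ y) (hzw : z ≠ w) (hxz : x ≠ z)
    (hxw : x ≠ w) (hyz : y ≠ z) (hyw : y ≠ w)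
    (hNz : ∀ t ∈ nbr G S z, t = x ∨ t = w ∨ t = y)
    (hNw : ∀ t ∈ nbr G S w, t = x ∨ t = z ∨ t = y) : HasTwins G S := by
  have hdeg : ∀ u p q r : V, (∀ t ∈ nbr G S u, t = p ∨ t = q ∨ t = r) →
      (nbr G S u).card ≤ 3 := by
    intro u p q r h
    exact (Finset.card_le_card (t := {p, q, r}) fun t ht => by simpa using h t ht).trans
      Finset.card_le_three
  have dz := hdeg _ _ _ _ hNz
  have dw := hdeg _ _ _ _ hNw
  have hzx := mem_nbr_of_not_hasLowVertex hK hlow hz hNz dw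
  have hzy := mem_nbr_of_not_hasLowVertex (x := y) (y := x) hK hlow hz
    (fun t ht => by have := hNz t ht; tauto) dw
  have hwx := mem_nbr_of_not_hasLowVertex hK hlow hw hNw dz
  have hwy := mem_nbr_of_not_hasLowVertex (x := y) (y := x) hK hlow hw
    (fun t ht => by have := hNw t ht; tauto) dz
  refine ⟨x, y, z, hz, w, hw, hxy, hzw, fun t => ⟨?_, ?_⟩, fun t => ⟨?_, ?_⟩⟩
  · rintro ⟨ht, htw⟩
    rcases hNz t ht with h | h | h
    exacts [Or.inl h, absurd h htw, Or.inr h]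
  · rintro (rfl | rfl)
    exacts [⟨hzx, hxw⟩, ⟨hzy, hyw⟩]
  · rintro ⟨ht, htw⟩
    rcases hNw t ht with h | h | h
    exacts [Or.inl h, absurd h htw, Or.inr h]
  · rintro (rfl | rfl)
    exacts [⟨hwx, hxz⟩, ⟨hwy, hyz⟩]

/-- In a minimal interval with at least two interior vertices, every piece of the dissection is
empty or an ear. An ear forces degree at least `K ≥ 5` on its ends, while cleanness bounds the
degree of a cut point. -/
theorem Clean.card_inside_le_one {K : ℕ} (hK : 5 ≤ K) (hG : SingleCrossing G)
    (hlow : ¬ HasLowVertex G S K) (htwins : ¬ HasTwins G S)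
    (hears : K = 5 → ¬ HasTwinsWithEars G S) : ∀ (n : ℕ) (x y : V), x ∈ S → y ∈ S →
      Clean G S x y → (inside S x y).card = n → n ≤ 1 := by
  intro n
  induction n using Nat.strong_induction_on with
  | _ n ih =>
  rintro x y hx hy hxy rfl
  by_contra! hcard
  have hrec : ∀ x' y', x' ∈ S → y' ∈ S → Clean G S x' y' → x ≤ x' → y' ≤ y →
      (x < x' ∧ x' < y ∨ x < y' ∧ y' < y) → (inside S x' y').card ≤ 1 := by
    intro x' y' hx' hy' hc hxx hyy hlt
    refine ih _ (Finset.card_lt_card ?_) x' y' hx' hy' hc rfl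
    refine ⟨fun t => ?_, fun hsub => ?_⟩
    · simp only [mem_inside]
      rintro ⟨h1, h2, h3⟩
      exact ⟨h1, by order, by order⟩
    · rcases hlt with hlt | hlt
      · have := hsub (mem_inside.2 ⟨hx', hlt⟩)
        simp at this
      · have := hsub (mem_inside.2 ⟨hy', hlt⟩)
        simp at this
  rcases hxy.dissect hG hy (Finset.card_pos.1 (by omega)) with
    ⟨z, hz, hxz, hzy, c1, c2⟩ | ⟨z, hz, w, hw, hxz, hzw, hwy, axw, azy, c1, c2, c3⟩
  · have i1 := hrec x z hx hz c1 le_rfl hzy.le (Or.inr ⟨hxz, hzy⟩)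
    have i2 := hrec z y hz hy c2 hxz.le le_rfl (Or.inl ⟨hxz, hzy⟩)
    have hsub : inside S x y ⊆ insert z (inside S x z ∪ inside S z y) := by
      intro t
      simp only [mem_inside, Finset.mem_insert, Finset.mem_union]
      rintro ⟨h1, h2, h3⟩
      rcases lt_trichotomy t z with h | h | h
      · exact Or.inr (Or.inl ⟨h1, h2, h⟩)
      · exact Or.inl h
      · exact Or.inr (Or.inr ⟨h1, h, h3⟩)
    have j1 := Finset.card_le_card hsub
    have j2 := Finset.card_insert_le z (inside S x z ∪ inside S z y)
    have j3 := Finset.card_union_le (inside S x z) (inside S z y)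
    have hdeg : nbr G S z ⊆ {x, y} ∪ (inside S x z ∪ inside S z y) := by
      intro t ht
      rw [mem_nbr] at ht
      have hc := hxy z hz t ht.1 hxz hzy ht.2
      have hne := ht.2.ne'
      simp only [mem_inside, Finset.mem_insert, Finset.mem_singleton, Finset.mem_union]
      grind
    have k1 := Finset.card_le_card hdeg
    have k2 := Finset.card_union_le {x, y} (inside S x z ∪ inside S z y)
    have k3 := Finset.card_le_two (a := x) (b := y)
    -- One piece is an ear, so `z` has degree at least five; but its neighbors are among `x`, `y`
    -- and at most two interior vertices of the pieces.
    by_cases h1 : (inside S x z).card = 1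
    · obtain ⟨-, -, -, -, -, -, -, h⟩ := c1.exists_ear hlow h1
      omega
    · obtain ⟨-, -, -, -, -, -, h, -⟩ := c2.exists_ear hlow
        (show (inside S z y).card = 1 by omega)
      omega
  · have i1 := hrec x z hx hz c1 le_rfl (by order) (Or.inr ⟨hxz, by order⟩)
    have i2 := hrec z w hz hw c2 hxz.le hwy.le (Or.inl ⟨hxz, by order⟩)
    have i3 := hrec w y hw hy c3 (by order) le_rfl (Or.inl ⟨by order, hwy⟩)
    have hNz : nbr G S z ⊆ {x, w, y} ∪ (inside S x z ∪ inside S z w) := by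
      intro t ht
      rw [mem_nbr] at ht
      have hc := hxy z hz t ht.1 hxz (by order) ht.2
      have hne := ht.2.ne'
      have hc3 := c3 t ht.1 z hz
      have := ht.2.symm
      simp only [mem_inside, Finset.mem_insert, Finset.mem_singleton, Finset.mem_union]
      rcases lt_trichotomy t z with h | h | h
      · grind
      · exact absurd h hne
      · rcases lt_trichotomy t w with h' | h' | h'
        · exact Or.inr (Or.inr ⟨ht.1, h, h'⟩)
        · exact Or.inl (Or.inr (Or.inl h'))
        · rcases hc.2.lt_or_eq with h'' | h''
          · exact absurd (hc3 h' h'' this).1 hzw.not_ge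
          · exact Or.inl (Or.inr (Or.inr h''))
    have hNw : nbr G S w ⊆ {x, z, y} ∪ (inside S z w ∪ inside S w y) := by
      intro t ht
      rw [mem_nbr] at ht
      have hc := hxy w hw t ht.1 (by order) hwy ht.2
      have hne := ht.2.ne'
      have hc1 := c1 t ht.1 w hw
      have := ht.2.symm
      simp only [mem_inside, Finset.mem_insert, Finset.mem_singleton, Finset.mem_union]
      rcases lt_trichotomy t w with h | h | h
      · rcases lt_trichotomy t z with h' | h' | h'
        · rcases hc.1.lt_or_eq with h'' | h''
          · exact absurd (hc1 h'' h' this).2 hzw.not_ge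
          · exact Or.inl (Or.inl h''.symm)
        · exact Or.inl (Or.inr (Or.inl h'))
        · exact Or.inr (Or.inl ⟨ht.1, h', h⟩)
      · exact absurd h hne
      · grind
    have k1 := Finset.card_le_card hNz
    have k2 := Finset.card_union_le {x, w, y} (inside S x z ∪ inside S z w)
    have k3 := Finset.card_union_le (inside S x z) (inside S z w)
    have k4 := Finset.card_le_three (a := x) (b := w) (c := y)
    have l1 := Finset.card_le_card hNw
    have l2 := Finset.card_union_le {x, z, y} (inside S z w ∪ inside S w y)
    have l3 := Finset.card_union_le (inside S z w) (inside S w y)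
    have l4 := Finset.card_le_three (a := x) (b := z) (c := y)
    have e1 : (inside S x z).card = 1 → K ≤ (nbr G S z).card := fun h => by
      obtain ⟨-, -, -, -, -, -, -, h'⟩ := c1.exists_ear hlow h
      exact h'
    have e2 : (inside S z w).card = 1 → K ≤ (nbr G S z).card ∧ K ≤ (nbr G S w).card := fun h => by
      obtain ⟨-, -, -, -, -, -, h'⟩ := c2.exists_ear hlow h
      exact h'
    have e3 : (inside S w y).card = 1 → K ≤ (nbr G S w).card := fun h => by
      obtain ⟨-, -, -, -, -, -, h', -⟩ := c3.exists_ear hlow h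
      exact h'
    -- Both `z` and `w` have degree at most five. A middle ear forces equality everywhere: `K = 5`,
    -- all three pieces are ears, and all possible edges at `z` and `w` are present.
    by_cases h2 : (inside S z w).card = 1
    · obtain ⟨hdz, hdw⟩ := e2 h2
      have h1 : (inside S x z).card = 1 := by omega
      have h3 : (inside S w y).card = 1 := by omega
      obtain ⟨p, hp, hxp, hpz, hip, hNp, -⟩ := c1.exists_ear hlow h1
      obtain ⟨q, hq, hzq, hqw, hiq, hNq, -⟩ := c2.exists_ear hlow h2
      obtain ⟨r, hr, hwr, hry, hir, hNr, -⟩ := c3.exists_ear hlow h3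
      have hz' := Finset.eq_of_subset_of_card_le hNz (by omega)
      have hw' := Finset.eq_of_subset_of_card_le hNw (by omega)
      refine hears (by omega) ⟨x, p, z, q, w, r, y, ?_, hz, hw, hp, hq, hr, ?_, ?_, ?_, ?_, ?_⟩
      · have : List.Pairwise (· < ·) [x, p, z, q, w, r, y] := by
          simp only [List.pairwise_cons, List.mem_cons, List.not_mem_nil, or_false]
          grind
        exact this.imp fun h => h.ne
      · intro t
        simp [hNp]
      · intro t
        simp [hNq]
      · intro t
        simp [hNr]
      · intro t
        rw [hz', hip, hiq]
        simp only [Finset.mem_union, Finset.mem_insert, Finset.mem_singleton, or_assoc]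
      · intro t
        rw [hw', hiq, hir]
        simp only [Finset.mem_union, Finset.mem_insert, Finset.mem_singleton, or_assoc]
    -- Without a middle ear, `z` and `w` have degree at most four, which excludes outer ears too;
    -- then `z` and `w` are twins.
    · have h1 : (inside S x z).card = 0 := by omega
      have h3 : (inside S w y).card = 0 := by omega
      have h2' : (inside S z w).card = 0 := by omega
      rw [Finset.card_eq_zero] at h1 h2' h3
      rw [h1, h2'] at hNz
      rw [h2', h3] at hNw
      simp only [Finset.union_empty] at hNz hNw
      exact htwins (hasTwins_of_not_hasLowVertex (x := x) (y := y) hK hlow hz hw (by order)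
        hzw.ne hxz.ne (by order) (by order) hwy.ne' (fun t ht => by simpa using hNz ht)
        fun t ht => by simpa using hNw ht)

/-- A nonempty graph drawn with single crossings is reducible. -/
theorem exists_reducible {K : ℕ} (hK : 5 ≤ K) (hG : SingleCrossing G) (hS : S.Nonempty) :
    HasLowVertex G S K ∨ HasTwins G S ∨ K = 5 ∧ HasTwinsWithEars G S := by
  by_contra! hcon
  obtain ⟨hlow, htwins, hears⟩ := hcon
  have hmin : ∀ t ∈ S, S.min' hS ≤ t := fun t ht => S.min'_le t ht
  have hmax : ∀ t ∈ S, t ≤ S.max' hS := fun t ht => S.le_max' t ht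
  have hcl : Clean G S (S.min' hS) (S.max' hS) := fun s _ t ht _ _ _ => ⟨hmin t ht, hmax t ht⟩
  have h1 := hcl.card_inside_le_one hK hG hlow htwins hears _ _ _ (S.min'_mem hS) (S.max'_mem hS)
    rfl
  have hsub : S ⊆ {S.min' hS, S.max' hS} ∪ inside S (S.min' hS) (S.max' hS) := by
    intro t ht
    have a1 := hmin t ht
    have a2 := hmax t ht
    simp only [mem_inside, Finset.mem_insert, Finset.mem_singleton, Finset.mem_union]
    rcases a1.lt_or_eq with b1 | b1
    · rcases a2.lt_or_eq with b2 | b2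
      · exact Or.inr ⟨ht, b1, b2⟩
      · exact Or.inl (Or.inr b2)
    · exact Or.inl (Or.inl b1.symm)
  -- The whole set is a clean interval with at most one interior vertex, so all degrees are at most
  -- two and any vertex is low.
  have hcard : S.card ≤ 3 := by
    have j1 := Finset.card_le_card hsub
    have j2 := Finset.card_union_le {S.min' hS, S.max' hS} (inside S (S.min' hS) (S.max' hS))
    have j3 := Finset.card_le_two (a := S.min' hS) (b := S.max' hS)
    omega
  have hdeg : ∀ u ∈ S, (nbr G S u).card ≤ 2 := by
    intro u hu
    have : nbr G S u ⊂ S := by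
      refine ⟨fun t ht => (mem_nbr.1 ht).1, fun hsub => ?_⟩
      exact G.loopless.irrefl u (mem_nbr.1 (hsub hu)).2
    have := Finset.card_lt_card this
    omega
  obtain ⟨u, hu⟩ := hS
  refine hlow ⟨u, hu, hdeg u hu, fun h2 => ?_⟩
  obtain ⟨v, hv⟩ := Finset.card_pos.1 (show 0 < (nbr G S u).card by omega)
  have := hdeg v (mem_nbr.1 hv).1
  exact ⟨v, hv, by omega⟩

end Structure

/-! ### Induction by reducible configurations -/

section Main

open scoped Classical

variable {V C : Type*} [Fintype C] {G : SimpleGraph V} {K : ℕ}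

theorem ColorableOn.of_hasLowVertex (hK : 5 ≤ K) (hC : Fintype.card C = K + 1) {S : Finset V}
    (hmax : ∀ v, (nbr G S v).card ≤ K) (h : HasLowVertex G S K)
    (ih : ∀ T : Finset V, T.card < S.card → ColorableOn G C T) : ColorableOn G C S := by
  obtain ⟨u, hu, hdeg, hred⟩ := h
  have hS : insert u (S.erase u) = S := Finset.insert_erase hu
  have hN : nbr G (S.erase u) u = nbr G S u := by
    conv_rhs => rw [← hS, nbr_insert_of_not_adj (G.loopless.irrefl u)]
  rw [← hS]
  refine ColorableOn.insert_of_card_le_two (K := K) (ih _ (Finset.card_erase_lt_of_mem hu))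
    (Finset.notMem_erase u S) (by omega) hC (by rwa [hS]) (by rwa [hN]) ?_
  rwa [hS, hN]

theorem ColorableOn.of_hasTwins (hK : 5 ≤ K) (hC : Fintype.card C = K + 1) {S : Finset V}
    (hmax : ∀ v, (nbr G S v).card ≤ K) (h : HasTwins G S)
    (ih : ∀ T : Finset V, T.card < S.card → ColorableOn G C T) : ColorableOn G C S := by
  obtain ⟨a, d, b, hb, c, hc, had, hbc, hNb, hNc⟩ := h
  have hS : insert c (insert b ((S.erase b).erase c)) = S := by grind
  have hlt : ((S.erase b).erase c).card < S.card :=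
    (Finset.card_le_card (Finset.erase_subset _ _)).trans_lt (Finset.card_erase_lt_of_mem hb)
  have hbb := G.loopless.irrefl b
  have hcc := G.loopless.irrefl c
  simp only [mem_nbr] at hNb hNc
  rw [← hS]
  refine ColorableOn.insert_twins (ih _ hlt) hK hC (a := a) (d := d) (by simp) (by simp) hbc had
    (by rwa [hS]) ?_ ?_
  · ext t
    have := hNb t
    simp only [mem_nbr, Finset.mem_erase, Finset.mem_insert, Finset.mem_singleton]
    grind
  · ext t
    have := hNc t
    simp only [mem_nbr, Finset.mem_erase, Finset.mem_insert, Finset.mem_singleton]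
    grind

theorem card_nbr_le_two_of_three {S T : Finset V} {a x y z : V} (hTS : T ⊆ S)
    (hdeg : (nbr G S a).card ≤ 5) (hxy : x ≠ y) (hxz : x ≠ z) (hyz : y ≠ z)
    (hx : x ∈ nbr G S a) (hy : y ∈ nbr G S a) (hz : z ∈ nbr G S a) (hxT : x ∉ T) (hyT : y ∉ T)
    (hzT : z ∉ T) : (nbr G T a).card ≤ 2 := by
  have hsub : nbr G T a ∪ {x, y, z} ⊆ nbr G S a := by
    intro t ht
    simp only [Finset.mem_union, Finset.mem_insert, Finset.mem_singleton] at ht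
    rcases ht with ht | rfl | rfl | rfl
    · exact mem_nbr.2 ⟨hTS (mem_nbr.1 ht).1, (mem_nbr.1 ht).2⟩
    all_goals assumption
  have hdisj : Disjoint (nbr G T a) {x, y, z} := by
    rw [Finset.disjoint_left]
    intro t ht
    have := (mem_nbr.1 ht).1
    simp only [Finset.mem_insert, Finset.mem_singleton]
    rintro (rfl | rfl | rfl) <;> contradiction
  have h1 := Finset.card_le_card hsub
  rw [Finset.card_union_of_disjoint hdisj, Finset.card_eq_three.2 ⟨x, y, z, hxy, hxz, hyz, rfl⟩]
    at h1
  omega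

theorem ColorableOn.of_hasTwinsWithEars (hC : Fintype.card C = 6) {S : Finset V}
    (hmax : ∀ v, (nbr G S v).card ≤ 5) (h : HasTwinsWithEars G S)
    (ih : ∀ T : Finset V, T.card < S.card → ColorableOn G C T) : ColorableOn G C S := by
  obtain ⟨a, p, b, q, c, r, d, hnd, hb, hc, hp, hq, hr, hNp, hNq, hNr, hNb, hNc⟩ := h
  simp only [List.nodup_cons, List.mem_cons, List.not_mem_nil, or_false, not_or,
    not_false_eq_true, List.nodup_nil, and_true] at hnd
  simp only [← ne_eq] at hnd
  obtain ⟨⟨ap, ab, aq, ac, ar, ad⟩, ⟨pb, pq, pc, pr, pd⟩, ⟨bq, bc, br, bd⟩, ⟨qc, qr, qd⟩,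
    ⟨cr, cd⟩, rd⟩ := hnd
  set T := S \ {b, c, p, q, r} with hT
  have hS : insert r (insert q (insert p (insert c (insert b T)))) = S := by
    ext t
    simp only [hT, Finset.mem_insert, Finset.mem_sdiff, Finset.mem_singleton]
    by_cases ht : t ∈ S
    · simp only [ht, true_and, iff_true]
      tauto
    · simp only [ht, false_and, or_false, iff_false, not_or]
      exact ⟨fun e => ht (e ▸ hr), fun e => ht (e ▸ hq), fun e => ht (e ▸ hp),
        fun e => ht (e ▸ hc), fun e => ht (e ▸ hb)⟩
  have hTS : T ⊆ S := Finset.sdiff_subset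
  have hbT : b ∉ T := by simp [hT]
  have hcT : c ∉ T := by simp [hT]
  have hpT : p ∉ T := by simp [hT]
  have hqT : q ∉ T := by simp [hT]
  have hrT : r ∉ T := by simp [hT]
  have hlt : T.card < S.card :=
    Finset.card_lt_card ⟨hTS, fun hsub => hbT (hsub hb)⟩
  have hmemT : ∀ t, t ∈ T ↔ t ∈ S ∧ t ≠ b ∧ t ≠ c ∧ t ≠ p ∧ t ≠ q ∧ t ≠ r := by
    intro t
    simp [hT]
  have hswap : ∀ u v, u ∈ S → v ∈ nbr G S u → u ∈ nbr G S v := fun u v hu hv =>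
    mem_nbr.2 ⟨hu, (mem_nbr.1 hv).2.symm⟩
  have hda : (nbr G T a).card ≤ 2 := card_nbr_le_two_of_three hTS (hmax a) pb.symm bc pc
    (hswap _ _ hb ((hNb a).2 (by simp))) (hswap _ _ hp ((hNp a).2 (by simp)))
    (hswap _ _ hc ((hNc a).2 (by simp))) hbT hpT hcT
  have hdd : (nbr G T d).card ≤ 2 := card_nbr_le_two_of_three hTS (hmax d) br bc cr.symm
    (hswap _ _ hb ((hNb d).2 (by simp))) (hswap _ _ hr ((hNr d).2 (by simp)))
    (hswap _ _ hc ((hNc d).2 (by simp))) hbT hrT hcT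
  have hadj : G.Adj b c := (mem_nbr.1 ((hNb c).2 (by simp))).2
  simp only [mem_nbr] at hNp hNq hNr hNb hNc
  have haS : a ∈ S := ((hNp a).2 (by simp)).1
  have hdS : d ∈ S := ((hNr d).2 (by simp)).1
  rw [← hS]
  refine ColorableOn.insert_twins_with_ears (ih T hlt) hC (a := a) (d := d) hbT hcT ad hadj
    ?_ ?_ hda hdd ?_ ?_ ?_ ?_ ?_ ?_
  · ext t
    have := hNb t
    simp only [mem_nbr, hmemT, Finset.mem_insert, Finset.mem_singleton]
    clear * - this ap ab aq ac ar pb pq pc pr pd bq bc br bd qc qr qd cr cd rd haS hb hc hp hq hr hdS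
    grind
  · ext t
    have := hNc t
    simp only [mem_nbr, hmemT, Finset.mem_insert, Finset.mem_singleton]
    clear * - this ap ab aq ac ar pb pq pc pr pd bq bc br bd qc qr qd cr cd rd haS hb hc hp hq hr hdS
    grind
  · simp [hpT, pb, pc]
  · simp [hqT, bq.symm, qc, pq.symm]
  · simp [hrT, br.symm, cr.symm, pr.symm, qr.symm]
  · ext t
    have := hNp t
    simp only [mem_nbr, hmemT, Finset.mem_insert, Finset.mem_singleton]
    clear * - this ap ab aq ac ar pb pq pc pr pd bq bc br bd qc qr qd cr cd rd haS hb hc hp hq hr hdS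
    grind
  · ext t
    have := hNq t
    simp only [mem_nbr, hmemT, Finset.mem_insert, Finset.mem_singleton]
    clear * - this ap ab aq ac ar pb pq pc pr pd bq bc br bd qc qr qd cr cd rd haS hb hc hp hq hr hdS
    grind
  · ext t
    have := hNr t
    simp only [mem_nbr, hmemT, Finset.mem_insert, Finset.mem_singleton]
    clear * - this ap ab aq ac ar pb pq pc pr pd bq bc br bd qc qr qd cr cd rd haS hb hc hp hq hr hdS
    grind

/-- If all nonempty vertex sets are reducible, then all of them are colorable. -/
theorem colorableOn_of_reducible (hK : 5 ≤ K) (hC : Fintype.card C = K + 1)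
    (hmax : ∀ S v, (nbr G S v).card ≤ K)
    (hred : ∀ S : Finset V, S.Nonempty →
      HasLowVertex G S K ∨ HasTwins G S ∨ K = 5 ∧ HasTwinsWithEars G S) (S : Finset V) :
    ColorableOn G C S := by
  induction hn : S.card using Nat.strong_induction_on generalizing S with
  | _ n ih =>
  subst hn
  have ih' : ∀ T : Finset V, T.card < S.card → ColorableOn G C T := fun T hT => ih _ hT T rfl
  rcases S.eq_empty_or_nonempty with rfl | hS
  · obtain ⟨c⟩ : Nonempty C := Fintype.card_pos_iff.1 (by omega)
    exact ⟨fun _ => c, fun _ _ => c, by constructor <;> simp⟩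
  · rcases hred S hS with h | h | ⟨rfl, h⟩
    · exact ColorableOn.of_hasLowVertex hK hC (hmax S) h ih'
    · exact ColorableOn.of_hasTwins hK hC (hmax S) h ih'
    · exact ColorableOn.of_hasTwinsWithEars hC (hmax S) h ih'

end Main

/-! ### Gluing along cut vertices -/

section Gluing

open scoped Classical

variable {V C : Type*} {G : SimpleGraph V} {K : ℕ}

theorem ColoringOn.comp_injective {S : Finset V} {f : V → C} {g : V → V → C}
    (h : ColoringOn G S f g) {σ : C → C} (hσ : Function.Injective σ) :
    ColoringOn G S (fun v => σ (f v)) fun u v => σ (g u v) where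
  symm u v := congrArg σ (h.symm u v)
  vertex u hu v hv huv := hσ.ne (h.vertex u hu v hv huv)
  edge u hu v hv w hw huv huw hvw := hσ.ne (h.edge u hu v hv w hw huv huw hvw)
  incident u hu v hv huv := hσ.ne (h.incident u hu v hv huv)

/-- A permutation of the colors with one prescribed value that maps a set of colors out of a
given set. -/
theorem exists_perm_notMem [Fintype C] {E U : Finset C} {a b : C} (ha : a ∉ E) (hb : b ∈ U)
    (hcard : E.card + U.card ≤ Fintype.card C) :
    ∃ σ : Equiv.Perm C, σ a = b ∧ ∀ x ∈ E, σ x ∉ U := by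
  obtain ⟨B, hB, hBE⟩ := Finset.exists_subset_card_eq (s := Uᶜ) (n := E.card) (by
    rw [Finset.card_compl]
    omega)
  let e : {x // x ∈ E} ≃ {x // x ∈ B} := Finset.equivOfCardEq hBE.symm
  let τ : Equiv.Perm C := e.extendSubtype
  have hτ : ∀ x ∈ E, τ x ∈ B := fun x hx => e.extendSubtype_mem x hx
  -- The swap corrects the value at `a` and fixes the images of `E`: these differ from `τ a` because
  -- `a ∉ E`, and from `b` because they avoid `U`.
  refine ⟨τ.trans (Equiv.swap (τ a) b), by simp, fun x hx => ?_⟩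
  have hxU : τ x ∉ U := Finset.mem_compl.1 (hB (hτ x hx))
  have h1 : τ x ≠ τ a := fun h => ha (τ.injective h ▸ hx)
  have h2 : τ x ≠ b := fun h => hxU (h ▸ hb)
  rw [Equiv.trans_apply, Equiv.swap_apply_of_ne_of_ne h1 h2]
  exact hxU

theorem ColoringOn.union {S₁ S₂ : Finset V} {f₁ f₂ : V → C} {g₁ g₂ : V → V → C}
    (h₁ : ColoringOn G S₁ f₁ g₁) (h₂ : ColoringOn G S₂ f₂ g₂)
    (hno : ∀ u ∈ S₁, ∀ v ∈ S₂, G.Adj u v → v ∈ S₁ ∨ u ∈ S₂)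
    (hf : ∀ v ∈ S₁, v ∈ S₂ → f₁ v = f₂ v)
    (hg : ∀ v ∈ S₁, v ∈ S₂ → ∀ u ∈ S₁, ∀ w ∈ S₂, G.Adj v u → G.Adj v w → g₁ v u ≠ g₂ v w) :
    ColorableOn G C (S₁ ∪ S₂) := by
  have hedge : ∀ u ∈ S₁ ∪ S₂, ∀ v ∈ S₁ ∪ S₂, G.Adj u v →
      u ∈ S₁ ∧ v ∈ S₁ ∨ ¬ (u ∈ S₁ ∧ v ∈ S₁) ∧ u ∈ S₂ ∧ v ∈ S₂ := by
    intro u hu v hv huv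
    have a1 := hno u
    have a2 := hno v
    have := huv.symm
    rw [Finset.mem_union] at hu hv
    grind
  refine ⟨fun v => if v ∈ S₁ then f₁ v else f₂ v,
    fun u v => if u ∈ S₁ ∧ v ∈ S₁ then g₁ u v else g₂ u v, ?_, ?_, ?_, ?_⟩
  · intro u v
    simp only [h₁.symm u v, h₂.symm u v, and_comm]
  · intro u hu v hv huv
    have a1 := h₁.vertex u
    have a2 := h₂.vertex u
    have a3 := hf u
    have a4 := hf v
    have := hedge u hu v hv huv
    grind
  · intro u hu v hv w hw huv huw hvw
    rcases hedge u hu v hv huv with e1 | ⟨n1, e1⟩ <;> rcases hedge u hu w hw huw with e2 | ⟨n2, e2⟩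
    · simpa only [if_pos e1, if_pos e2] using h₁.edge u e1.1 v e1.2 w e2.2 huv huw hvw
    · simpa only [if_pos e1, if_neg n2] using hg u e1.1 e2.1 v e1.2 w e2.2 huv huw
    · simpa only [if_neg n1, if_pos e2] using (hg u e2.1 e1.1 w e2.2 v e1.2 huw huv).symm
    · simpa only [if_neg n1, if_neg n2] using h₂.edge u e1.1 v e1.2 w e2.2 huv huw hvw
  · intro u hu v hv huv
    rcases hedge u hu v hv huv with e1 | ⟨n1, e1⟩
    · simpa only [if_pos e1, if_pos e1.1] using h₁.incident u e1.1 v e1.2 huv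
    · have h := h₂.incident u e1.1 v e1.2 huv
      have a3 := hf u
      simp only [if_neg n1]
      grind

/-- Total colorings of two graphs that share at most one vertex can be combined. -/
theorem ColorableOn.union [Fintype C] (hC : Fintype.card C = K + 1) {S₁ S₂ : Finset V}
    (h₁ : ColorableOn G C S₁) (h₂ : ColorableOn G C S₂)
    (hmax : ∀ v, (nbr G (S₁ ∪ S₂) v).card ≤ K)
    (hno : ∀ u ∈ S₁, ∀ v ∈ S₂, G.Adj u v → v ∈ S₁ ∨ u ∈ S₂)
    (hint : ∀ u ∈ S₁, u ∈ S₂ → ∀ v ∈ S₁, v ∈ S₂ → u = v) : ColorableOn G C (S₁ ∪ S₂) := by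
  obtain ⟨f₁, g₁, h₁⟩ := h₁
  obtain ⟨f₂, g₂, h₂⟩ := h₂
  by_cases hv : ∃ v, v ∈ S₁ ∧ v ∈ S₂
  · obtain ⟨v, hv1, hv2⟩ := hv
    have hdisj : Disjoint (nbr G S₁ v) (nbr G S₂ v) := by
      rw [Finset.disjoint_left]
      intro u hu1 hu2
      rw [mem_nbr] at hu1 hu2
      exact hu1.2.ne (hint v hv1 hv2 u hu1.1 hu2.1)
    have hcard : (nbr G S₁ v).card + (nbr G S₂ v).card ≤ K := by
      rw [← Finset.card_union_of_disjoint hdisj]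
      refine (Finset.card_le_card fun t => ?_).trans (hmax v)
      simp only [Finset.mem_union, mem_nbr]
      tauto
    have hn : f₂ v ∉ (nbr G S₂ v).image (g₂ v) := by
      simp only [Finset.mem_image, mem_nbr, not_exists, not_and]
      exact fun u hu => (h₂.incident v hv2 u hu.1 hu.2).symm
    have hE := Finset.card_image_le (s := nbr G S₂ v) (f := g₂ v)
    have hU := card_used_le (G := G) (S := S₁) (f := f₁) (g := g₁) v
    have hmem : f₁ v ∈ used G S₁ f₁ g₁ v := Finset.mem_insert_self _ _
    -- The edges at `v` in `S₂` and the colors at `v` in `S₁` number at most `K + 1` together, so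
    -- there is room to keep them apart.
    obtain ⟨σ, hσ, hσ'⟩ := exists_perm_notMem hn hmem (by omega)
    refine h₁.union (h₂.comp_injective σ.injective) hno ?_ ?_
    · intro u hu1 hu2
      obtain rfl := hint v hv1 hv2 u hu1 hu2
      exact hσ.symm
    · intro u hu1 hu2 x hx y hy hux huy heq
      obtain rfl := hint v hv1 hv2 u hu1 hu2
      refine hσ' (g₂ v y) (Finset.mem_image_of_mem _ (mem_nbr.2 ⟨hy, huy⟩)) ?_
      rw [← heq]
      exact Finset.mem_insert_of_mem (Finset.mem_image_of_mem _ (mem_nbr.2 ⟨hx, hux⟩))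
  · push Not at hv
    exact h₁.union h₂ hno (fun v h h' => absurd h' (hv v h)) fun v h h' => absurd h' (hv v h)

theorem exists_separation_of_not_preconnected {A : G.Subgraph} (hA : ¬ A.Preconnected) :
    ∃ P : Set V, (∃ x ∈ A.verts, x ∈ P) ∧ (∃ y ∈ A.verts, y ∉ P) ∧
      ∀ u ∈ P, ∀ w ∈ A.verts, w ∉ P → ¬ A.Adj u w := by
  have hA' : ¬ A.coe.Preconnected := fun h => hA ⟨h⟩
  simp only [SimpleGraph.Preconnected, not_forall] at hA'
  obtain ⟨x, y, hxy⟩ := hA'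
  refine ⟨{u | ∃ h : u ∈ A.verts, A.coe.Reachable x ⟨u, h⟩}, ⟨x, x.2, x.2, .refl _⟩,
    ⟨y, y.2, fun ⟨_, h⟩ => hxy h⟩, ?_⟩
  rintro u ⟨hu, hxu⟩ w hw hwP huw
  have hadj : A.coe.Adj ⟨u, hu⟩ ⟨w, hw⟩ := huw
  exact hwP ⟨hw, hxu.trans hadj.reachable⟩

/-- A separable vertex set is the union of two smaller sets that share at most one vertex and have
no edges between them otherwise. -/
theorem exists_split {S : Finset V} (hS : S.Nonempty)
    (h : ¬ Nonseparable ((⊤ : G.Subgraph).induce S)) : ∃ S₁ S₂ : Finset V, S₁ ∪ S₂ = S ∧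
      S₁.card < S.card ∧ S₂.card < S.card ∧
      (∀ u ∈ S₁, ∀ v ∈ S₂, G.Adj u v → v ∈ S₁ ∨ u ∈ S₂) ∧
      ∀ u ∈ S₁, u ∈ S₂ → ∀ v ∈ S₁, v ∈ S₂ → u = v := by
  -- Taking `X` empty or a single vertex treats disconnected sets and cut vertices alike.
  obtain ⟨X, hX, hXS, hdel⟩ : ∃ X : Set V, X.Subsingleton ∧ X ⊆ S ∧
      ¬ (((⊤ : G.Subgraph).induce S).deleteVerts X).Preconnected := by
    by_contra! hcon
    refine h ⟨SimpleGraph.Subgraph.connected_iff.2 ⟨?_, ?_⟩, fun v hv => ?_⟩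
    · simpa using hcon ∅ Set.subsingleton_empty (Set.empty_subset _)
    · obtain ⟨x, hx⟩ := hS
      exact ⟨x, hx⟩
    · exact hcon {v} Set.subsingleton_singleton (by simpa using hv)
  obtain ⟨P, ⟨x, hx, hxP⟩, ⟨y, hy, hyP⟩, hP⟩ := exists_separation_of_not_preconnected hdel
  simp only [SimpleGraph.Subgraph.induce_verts,
    Set.mem_sdiff, Finset.mem_coe] at hx hy hP
  have hP' : ∀ u ∈ S, u ∉ X → u ∈ P → ∀ w ∈ S, w ∉ X → w ∉ P → ¬ G.Adj u w := by
    intro u hu huX huP w hw hwX hwP huw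
    exact hP u huP w ⟨hw, hwX⟩ hwP (by simp [hu, huX, hw, hwX, huw])
  refine ⟨S.filter fun v => v ∈ X ∨ v ∈ P, S.filter fun v => v ∈ X ∨ v ∉ P, ?_, ?_, ?_, ?_, ?_⟩
  · ext v
    simp only [Finset.mem_union, Finset.mem_filter]
    tauto
  · refine Finset.card_lt_card (Finset.filter_ssubset.2 ⟨y, hy.1, ?_⟩)
    simp [hy.2, hyP]
  · refine Finset.card_lt_card (Finset.filter_ssubset.2 ⟨x, hx.1, ?_⟩)
    simp [hx.2, hxP]
  · intro u hu v hv huv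
    simp only [Finset.mem_filter] at hu hv ⊢
    by_contra! hcon
    have := hP' u hu.1 (by tauto) (by tauto) v hv.1 (by tauto) (by tauto)
    exact this huv
  · intro u hu hu' v hv hv'
    simp only [Finset.mem_filter] at hu hu' hv hv'
    exact hX (by tauto) (by tauto)

/-- A nonseparable induced subgraph of a pseudo-outerplanar graph can be drawn with single
crossings. -/
theorem IsPseudoOuterplanar.exists_singleCrossing [Fintype V] (hG : IsPseudoOuterplanar G)
    {S : Finset V} (hS : Nonseparable ((⊤ : G.Subgraph).induce S)) :
    ∃ _ : LinearOrder (S : Set V), SingleCrossing (G.induce (S : Set V)) := by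
  -- By finiteness the nonseparable subgraph extends to a block, whose drawing is restricted.
  obtain ⟨B, hSB, hB⟩ := (Set.toFinite {H : G.Subgraph | Nonseparable H}).exists_le_maximal hS
  obtain ⟨D, hD⟩ := hG B hB
  refine D.exists_singleCrossing hD _ (fun v => ⟨v.1, hSB.1 v.2⟩) ?_ ?_
  · intro u v huv
    exact Subtype.ext (Subtype.mk.inj huv)
  · intro u v huv
    exact hSB.2 ⟨u.2, v.2, huv⟩

theorem ColorableOn.of_induce {S : Finset V} (hC : Nonempty C)
    (h : ColorableOn (G.induce (S : Set V)) C Finset.univ) : ColorableOn G C S := by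
  obtain ⟨c⟩ := hC
  obtain ⟨f, g, h⟩ := h
  refine ⟨fun v => if hv : v ∈ (S : Set V) then f ⟨v, hv⟩ else c,
    fun u v => if huv : u ∈ (S : Set V) ∧ v ∈ (S : Set V) then g ⟨u, huv.1⟩ ⟨v, huv.2⟩ else c,
    ?_, ?_, ?_, ?_⟩
  · intro u v
    by_cases hu : u ∈ (S : Set V) <;> by_cases hv : v ∈ (S : Set V) <;> simp only [hu, hv,
      and_self, and_true, and_false, dite_true, dite_false]
    exact h.symm _ _
  · intro u hu v hv huv
    rw [← Finset.mem_coe] at hu hv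
    simp only [hu, hv, dite_true]
    exact h.vertex _ (Finset.mem_univ _) _ (Finset.mem_univ _) huv
  · intro u hu v hv w hw huv huw hvw
    rw [← Finset.mem_coe] at hu hv hw
    simp only [hu, hv, hw, and_self, dite_true]
    exact h.edge _ (Finset.mem_univ _) _ (Finset.mem_univ _) _ (Finset.mem_univ _) huv huw
      fun e => hvw (congrArg Subtype.val e)
  · intro u hu v hv huv
    rw [← Finset.mem_coe] at hu hv
    simp only [hu, hv, and_self, dite_true]
    exact h.incident _ (Finset.mem_univ _) _ (Finset.mem_univ _) huv

theorem IsPseudoOuterplanar.colorableOn [Fintype V] [Fintype C] (hG : IsPseudoOuterplanar G)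
    (hK : 5 ≤ K) (hC : Fintype.card C = K + 1) (hmax : ∀ S v, (nbr G S v).card ≤ K)
    (S : Finset V) : ColorableOn G C S := by
  have hne : Nonempty C := Fintype.card_pos_iff.1 (by omega)
  induction hn : S.card using Nat.strong_induction_on generalizing S with
  | _ n ih =>
  subst hn
  rcases S.eq_empty_or_nonempty with rfl | hS
  · exact ⟨fun _ => hne.some, fun _ _ => hne.some, by constructor <;> simp⟩
  by_cases hsep : Nonseparable ((⊤ : G.Subgraph).induce S)
  -- No further splitting is needed here: the order on `S` serves all of its subsets, so the
  -- reducibility induction runs inside `G.induce S`.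
  · refine ColorableOn.of_induce hne (colorableOn_of_reducible hK hC ?_ ?_ _)
    · intro T v
      refine le_trans (Finset.card_le_card_of_injOn (t := nbr G Finset.univ v.1) Subtype.val ?_ ?_)
        (hmax Finset.univ v.1)
      · intro u hu
        have hu' := (mem_nbr.1 (Finset.mem_coe.1 hu)).2
        simpa using hu'
      · exact Subtype.val_injective.injOn
    · intro T hT
      obtain ⟨ord, hord⟩ := hG.exists_singleCrossing hsep
      exact exists_reducible hK hord hT
  · obtain ⟨S₁, S₂, rfl, hc1, hc2, hno, hint⟩ := exists_split hS hsep
    exact ColorableOn.union hC (ih _ hc1 S₁ rfl) (ih _ hc2 S₂ rfl) (hmax _) hno hint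

end Gluing

/-! ### Total chromatic number and lower bound -/

theorem totalColorable_of_colorableOn {V : Type*} [Fintype V] {G : SimpleGraph V} {k : ℕ}
    (h : ColorableOn G (Fin k) Finset.univ) : TotalColorable G k := by
  obtain ⟨f, g, h⟩ := h
  have hu : ∀ v : V, v ∈ Finset.univ := Finset.mem_univ
  let c : Sym2 V → Fin k := Sym2.lift ⟨g, h.symm⟩
  refine ⟨f, fun e => c e.1, fun u v huv => h.vertex u (hu u) v (hu v) huv, ?_, ?_⟩
  · rintro ⟨e, he⟩ ⟨e', he'⟩ hne ⟨v, hv, hv'⟩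
    obtain ⟨x, rfl⟩ := Sym2.mem_iff_exists.1 hv
    obtain ⟨y, rfl⟩ := Sym2.mem_iff_exists.1 hv'
    exact h.edge v (hu v) x (hu x) y (hu y) he he' fun hxy => hne (by subst hxy; rfl)
  · rintro v ⟨e, he⟩ hv
    obtain ⟨x, rfl⟩ := Sym2.mem_iff_exists.1 hv
    exact h.incident v (hu v) x (hu x) he

/-- All vertices and edges get different colors; `Option` keeps the number of colors positive for an
empty graph. This makes the infimum in `totalChromaticNumber` attained. -/
theorem totalColorable_card {V : Type*} [Fintype V] (G : SimpleGraph V) :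
    ∃ k, 0 < k ∧ TotalColorable G k := by
  classical
  let e := Fintype.equivFin (Option (V ⊕ G.edgeSet))
  refine ⟨Fintype.card (Option (V ⊕ G.edgeSet)), Fintype.card_pos,
    fun v => e (some (Sum.inl v)), fun a => e (some (Sum.inr a)), ?_, ?_, ?_⟩
  · intro u v huv h
    simp [huv.ne] at h
  · intro a b hab _ h
    simp [hab] at h
  · intro v a _ h
    simp at h

theorem TotalColorable.degree_lt {V : Type*} {G : SimpleGraph V} {k : ℕ} (h : TotalColorable G k)
    (v : V) [Fintype (G.neighborSet v)] : G.degree v + 1 ≤ k := by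
  obtain ⟨c⟩ := h
  let φ : Option (G.neighborSet v) → Fin k := fun o =>
    o.elim (c.vertexColor v) fun w => c.edgeColor ⟨s(v, w.1), w.2⟩
  have hφ : Function.Injective φ := by
    rintro (_ | ⟨x, hx⟩) (_ | ⟨y, hy⟩) h
    · rfl
    · exact absurd h (c.incident_ne v _ (Sym2.mem_mk_left _ _))
    · exact absurd h.symm (c.incident_ne v _ (Sym2.mem_mk_left _ _))
    · by_contra hne
      refine c.edge_ne ⟨s(v, x), hx⟩ ⟨s(v, y), hy⟩ (fun heq => hne ?_)
        ⟨v, Sym2.mem_mk_left _ _, Sym2.mem_mk_left _ _⟩ h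
      have hxy : x = y := Sym2.congr_right.1 (congrArg Subtype.val heq)
      subst hxy
      rfl
  have := Fintype.card_le_of_injective φ hφ
  rwa [Fintype.card_option, Fintype.card_fin, SimpleGraph.card_neighborSet_eq_degree] at this

theorem TotalColorable.maxDegree_lt {V : Type*} [Fintype V] {G : SimpleGraph V}
    [DecidableRel G.Adj] {k : ℕ} (hk : 0 < k) (h : TotalColorable G k) : G.maxDegree + 1 ≤ k := by
  rcases isEmpty_or_nonempty V with hV | hV
  · rw [SimpleGraph.maxDegree_of_subsingleton]
    exact hk
  · obtain ⟨v, hv⟩ := G.exists_maximal_degree_vertex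
    rw [hv]
    exact h.degree_lt v

end PseudoOuterplanar

theorem mainTheorem2 {V : Type*} [Fintype V] (G : SimpleGraph V) [DecidableRel G.Adj] :
    G.maxDegree + 1 ≤ PseudoOuterplanar.totalChromaticNumber G ∧
      (PseudoOuterplanar.IsPseudoOuterplanar G → 5 ≤ G.maxDegree →
        PseudoOuterplanar.TotalColorable G (G.maxDegree + 1) ∧
          PseudoOuterplanar.totalChromaticNumber G = G.maxDegree + 1) := by
  have hmem := Nat.sInf_mem (PseudoOuterplanar.totalColorable_card G)
  have hlower : G.maxDegree + 1 ≤ PseudoOuterplanar.totalChromaticNumber G :=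
    hmem.2.maxDegree_lt hmem.1
  refine ⟨hlower, fun hG hK => ?_⟩
  have hcol : PseudoOuterplanar.TotalColorable G (G.maxDegree + 1) := by
    refine PseudoOuterplanar.totalColorable_of_colorableOn
      (hG.colorableOn hK (Fintype.card_fin _) (fun S v => ?_) _)
    refine le_trans ?_ (G.degree_le_maxDegree v)
    rw [← SimpleGraph.card_neighborFinset_eq_degree]
    refine Finset.card_le_card fun u hu => ?_
    rw [SimpleGraph.mem_neighborFinset]
    exact (PseudoOuterplanar.mem_nbr.1 hu).2
  exact ⟨hcol, le_antisymm (Nat.sInf_le ⟨Nat.succ_pos _, hcol⟩) hlower⟩
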